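/- **Definitions.** A code $C\subseteq V$ of a graph $G=(V,E)$ is *locating-dominating* (an *LD-code*) if $N[v]\cap C\neq\emptyset$ for every vertex $v$, and $N[u]\cap C\ne N[v]\cap C$ for any two distinct vertices $u,v\notin C$. The *square grid* has vertex set $\mathbb Z^2$, with $(i,j)$ and $(k,l)$ adjacent iff $|i-k|+|j-l|=1$. The *infinite strip* of height $h$ is its subgraph induced by $\{(i,j):1\le i\le h\}$. The *circular strip* of height $h$ and size $n$ is obtained from the subgraph induced by $\{1,\dots,h\}\times\{1,\dots,n\}$ by adding the edges $(i,n)(i',1)$ for which $(i,n)(i',n+1)$ is an edge of the grid. Let $LD^{\mathcal S}(n,h)$ be the minimum cardinality of an LD-code of this circular strip. The density of a code $C$ is $|C|/(nh)$ in a circular strip, and $\limsup_{m\to\infty}|C\cap V_m|/|V_m|$ in the infinite strip, where $V_m$ is the set of vertices $(i,j)$ of the strip with $|j|\le m$. **Proposition.** For every $n\ge 5$: - $h=1$: $LD^{\mathcal S}(n,1)=\left\lceil \frac{2n}{5}\right\rceil$. - $h=2$: $LD^{\mathcal S}(n,2)=\left\lceil\frac{3n}{4}\right\rceil$ if $n\not\equiv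 4 \pmod 8$, and $LD^{\mathcal S}(n,2)=\frac{3n}{4}+1$ if $n\equiv 4\pmod 8$. - $h=3$: $LD^{\mathcal S}(n,3)=n$ if $n\equiv 0,2,3,4\pmod 6$, and $LD^{\mathcal S}(n,3)=n+1$ if $n\equiv 1,5\pmod 6$. Consequently, for $h=1,2,3$ and with $(p,c)=(5,2),(8,6),(6,6)$ respectively, $LD^{\mathcal S}(n+p,h)=LD^{\mathcal S}(n,h)+c$ for all $n\ge5$, and $p$ is the least positive integer for which such a relation (with some constant in place of $c$) holds for all sufficiently large $n$. With $\lambda=c/p$, the minimum density of an LD-code of the infinite square strip of height $h$ exists and equals $\lambda/h$, that is $\frac25,\frac38,\frac13$ respectively. Moreover, for $q=5,8,2$ respectively, there is a pattern of $q$ columns whose periodic repetition is an LD-code of density $\lambda/h$ in the infinite strip of height $h$ and in every circular strip of height $h$ whose size is at least $5$ and a multiple of $q$. -/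

import Mathlib

namespace GridCodes

/-! ### Codes in graphs -/

section Codes

variable {V : Type*} (G : SimpleGraph V)

/-- The closed neighborhood `N[v]`. -/
def closedNeighborhood (v : V) : Set V := insert v (G.neighborSet v)

/-- `v` is dominated by the code `C`. -/
def IsDominated (C : Set V) (v : V) : Prop := (closedNeighborhood G v ∩ C).Nonempty

/-- `u` and `v` are separated by the code `C`. -/
def IsSeparated (C : Set V) (u v : V) : Prop :=
  closedNeighborhood G u ∩ C ≠ closedNeighborhood G v ∩ C

/-- `C` is a dominating code. -/
def IsDominatingCode (C : Set V) : Prop := ∀ v, IsDominated G C v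

/-- `C` is a locating-dominating code: it is dominating, and any two distinct vertices outside
`C` are separated by `C`. -/
def IsLDCode (C : Set V) : Prop :=
  IsDominatingCode G C ∧ ∀ u v, u ∉ C → v ∉ C → u ≠ v → IsSeparated G C u v

theorem isLDCode_univ : IsLDCode G Set.univ :=
  ⟨fun v => ⟨v, Set.mem_insert _ _, Set.mem_univ _⟩, fun u _ hu => absurd (Set.mem_univ u) hu⟩

end Codes

/-! ### The square grid and its strips -/

/-- The square grid on `ℤ × ℤ`: `(i, j)` and `(k, l)` are adjacent iff `|i - k| + |j - l| = 1`. -/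
def squareGrid : SimpleGraph (ℤ × ℤ) where
  Adj u v := |u.1 - v.1| + |u.2 - v.2| = 1
  symm := ⟨fun u v h => by rw [abs_sub_comm v.1, abs_sub_comm v.2]; exact h⟩
  loopless := ⟨fun u h => by simp at h⟩

/-- Vertices of the infinite strip of height `h`: the `(i, j)` with `1 ≤ i ≤ h`. -/
def infiniteStripVertices (h : ℕ) : Set (ℤ × ℤ) := {v | v.1 ∈ Set.Icc (1 : ℤ) h}

/-- The infinite square strip of height `h`. -/
def infiniteStrip (h : ℕ) : SimpleGraph (infiniteStripVertices h) :=
  squareGrid.induce (infiniteStripVertices h)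

/-- Vertices of the finite strip of height `h` and size `s`. -/
def stripVertices (h s : ℕ) : Set (ℤ × ℤ) := Set.Icc (1 : ℤ) h ×ˢ Set.Icc (1 : ℤ) s

/-- The finite square strip of height `h` and size `s`. -/
def strip (h s : ℕ) : SimpleGraph (stripVertices h s) :=
  squareGrid.induce (stripVertices h s)

/-- The circular square strip of height `h` and size `s`: add to the finite strip every edge
joining `(i, s)` to `(i', 1)` such that `(i, s)(i', s + 1)` is an edge of the grid. -/
def circularStrip (h s : ℕ) : SimpleGraph (stripVertices h s) :=
  strip h s ⊔ SimpleGraph.fromRel fun u v =>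
    u.1.2 = s ∧ v.1.2 = 1 ∧ squareGrid.Adj (u.1.1, (s : ℤ)) (v.1.1, (s : ℤ) + 1)

/-- `LD^S(n, h)`: the minimum cardinality of a locating-dominating code in the circular square
strip of size `n` and height `h`. -/
noncomputable def LDS (n h : ℕ) : ℕ :=
  sInf {k | ∃ C : Set (stripVertices h n), IsLDCode (circularStrip h n) C ∧ C.ncard = k}

instance (h s : ℕ) : Finite (stripVertices h s) :=
  ((Set.finite_Icc _ _).prod (Set.finite_Icc _ _)).to_subtype

/-- The infimum defining `LDS` is a minimum over finite sets. -/
theorem isLeast_LDS (n h : ℕ) :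
    IsLeast {k | ∃ C : Set (stripVertices h n),
      C.Finite ∧ IsLDCode (circularStrip h n) C ∧ C.ncard = k} (LDS n h) := by
  have hne : {k | ∃ C : Set (stripVertices h n),
      IsLDCode (circularStrip h n) C ∧ C.ncard = k}.Nonempty :=
    ⟨_, Set.univ, isLDCode_univ _, rfl⟩
  constructor
  · obtain ⟨C, hC, hk⟩ := Nat.sInf_mem hne
    exact ⟨C, C.toFinite, hC, hk⟩
  · rintro k ⟨C, -, hC, hk⟩
    exact Nat.sInf_le ⟨C, hC, hk⟩

/-! ### Densities -/

/-- The density `|C| / |V|` of a code `C` in the circular strip of height `h` and size `s`. -/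
noncomputable def circularDensity (h s : ℕ) (C : Set (stripVertices h s)) : ℝ :=
  (C.ncard : ℝ) / (Nat.card (stripVertices h s) : ℝ)

/-- `V_n`: the vertices of the infinite strip in the columns numbered from `-n` to `n`. -/
def window (h n : ℕ) : Set (infiniteStripVertices h) := {v | |v.1.2| ≤ (n : ℤ)}

/-- The density `limsup |C ∩ V_n| / |V_n|` of a code `C` in the infinite strip of height `h`. -/
noncomputable def density (h : ℕ) (C : Set (infiniteStripVertices h)) : ℝ :=
  Filter.limsup (fun n : ℕ => ((C ∩ window h n).ncard : ℝ) / ((window h n).ncard : ℝ))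
    Filter.atTop

/-- `d` is the minimum density of a locating-dominating code of the infinite strip of
height `h`. -/
def IsMinDensity (h : ℕ) (d : ℝ) : Prop :=
  IsLeast {x | ∃ C, IsLDCode (infiniteStrip h) C ∧ density h C = x} d

/-- There is one pattern of `q` columns whose periodic repetition is a locating-dominating code
of density `d` both in the infinite strip of height `h` and in each circular strip of height `h`
whose size is at least `5` and a multiple of `q`. -/
def HasPeriodicPattern (h q : ℕ) (d : ℝ) : Prop :=
  ∃ P : Set (ℤ × ℤ), (∀ i j : ℤ, (i, j + q) ∈ P ↔ (i, j) ∈ P) ∧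
    IsLDCode (infiniteStrip h) (Subtype.val ⁻¹' P) ∧
    density h (Subtype.val ⁻¹' P) = d ∧
    ∀ n : ℕ, 5 ≤ n → q ∣ n →
      IsLDCode (circularStrip h n) (Subtype.val ⁻¹' P) ∧
      circularDensity h n (Subtype.val ⁻¹' P) = d

/-! ### Pseudo-periodic sequences -/

/-- The sequence `a` satisfies `a (n + p) = a n + c` for all `n ≥ u`. -/
def PseudoPeriodic (a : ℕ → ℕ) (c p u : ℕ) : Prop := ∀ n, u ≤ n → a (n + p) = a n + c

/-- From index `5` on, `a` is pseudo-periodic with period `p` and transfer factor `c`, and `p` is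
the least positive period that `a` has from any start. -/
def HasPeriodAndTransferFactor (a : ℕ → ℕ) (p c : ℕ) : Prop :=
  PseudoPeriodic a c p 5 ∧ IsLeast {q | 0 < q ∧ ∃ d u, PseudoPeriodic a d q u} p

end GridCodes

/-! For n ≥ 5 the infinite strip covers the circular strip of size n, injectively at the range that
domination and separation can see (`isLDCode_infiniteStrip_wrap_iff`). Circular codes are therefore
the n-periodic codes of the infinite strip. Write each column as a number below 2^h: being an
LD-code becomes a condition `windowOK` on every five consecutive columns (`isLDCode_bitCode_iff`).
So codes are bi-infinite walks in a finite graph whose states are four consecutive columns, circular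
codes are closed walks, and code sizes are weights of walks.

Lower bounds are certificates for a minimum mean cycle. If N + φ(next state) ≤ D · (weight of the
step) + φ(state) always holds, then summing telescopes: a closed walk of length n weighs at least N
n / D, and, φ being bounded, every code of the infinite strip has density at least N / (D h). The
tables `potential₁`, `potential₂`, `potential₃` are such φ, checked on all windows by evaluation.
Rounding up is not enough when n ≡ 4 mod 8 (h = 2) or n ≡ 1, 5 mod 6 (h = 3). There equality would
make every step tight, and tight steps advance a phase modulo 8, respectively modulo 2 or 3, so this
modulus would divide n (`IsPotential.exists_phase_dvd`).

Upper bounds come from one explicit word per residue class, into which an optimal periodic word with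
the same first four columns is inserted any number of times (`LDS_add_mul_le`). Repeating an optimal
word also attains the minimum density. The minimality of the periods is read off the closed
formulas. -/

namespace GridCodes

/-! ### Locating-dominating codes and coverings -/

section Covering

variable {V W : Type*}

theorem isDominated_iff {G : SimpleGraph V} {C : Set V} {v : V} :
    IsDominated G C v ↔ v ∈ C ∨ ∃ w ∈ C, G.Adj v w := by
  constructor
  · rintro ⟨w, hw | hw, hC⟩
    · exact Or.inl (hw ▸ hC)
    · exact Or.inr ⟨w, hC, hw⟩
  · rintro (h | ⟨w, hC, hw⟩)
    · exact ⟨v, Or.inl rfl, h⟩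
    · exact ⟨w, Or.inr hw, hC⟩

/-- Only vertices outside the code that have a common neighbor need to be separated. -/
theorem isLDCode_iff {G : SimpleGraph V} {C : Set V} :
    IsLDCode G C ↔ (∀ v, v ∈ C ∨ ∃ w ∈ C, G.Adj v w) ∧
      ∀ u v x, u ≠ v → G.Adj u x → G.Adj v x → u ∉ C → v ∉ C →
        ∃ y ∈ C, ¬ (G.Adj u y ↔ G.Adj v y) := by
  have key : ∀ u v, u ∉ C → v ∉ C → (IsSeparated G C u v ↔
      ∃ y ∈ C, ¬ (G.Adj u y ↔ G.Adj v y)) := by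
    intro u v hu hv
    have hmem : ∀ w, w ∉ C → ∀ y, y ∈ closedNeighborhood G w ∩ C ↔ G.Adj w y ∧ y ∈ C := by
      intro w hw y
      constructor
      · rintro ⟨rfl | hy, hC⟩
        · exact absurd hC hw
        · exact ⟨hy, hC⟩
      · rintro ⟨hy, hC⟩
        exact ⟨Or.inr hy, hC⟩
    rw [IsSeparated, Ne, Set.ext_iff]
    simp only [hmem u hu, hmem v hv]
    push Not
    constructor
    · rintro ⟨y, ⟨⟨h1, h2⟩, h3⟩ | ⟨h1, h2, h3⟩⟩
      · exact ⟨y, h2, Or.inl ⟨h1, fun h => h3 h h2⟩⟩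
      · exact ⟨y, h3, Or.inr ⟨fun h => h1 h h3, h2⟩⟩
    · rintro ⟨y, hC, ⟨h1, h2⟩ | ⟨h1, h2⟩⟩
      · exact ⟨y, Or.inl ⟨⟨h1, hC⟩, fun h => absurd h h2⟩⟩
      · exact ⟨y, Or.inr ⟨fun h => absurd h h1, h2, hC⟩⟩
  constructor
  · rintro ⟨hd, hs⟩
    exact ⟨fun v => isDominated_iff.1 (hd v),
      fun u v x huv _ _ hu hv => (key u v hu hv).1 (hs u v hu hv huv)⟩
  · rintro ⟨hd, hs⟩
    refine ⟨fun v => isDominated_iff.2 (hd v), fun u v hu hv huv => (key u v hu hv).2 ?_⟩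
    -- A codeword x dominating u either separates u from v itself or is a common neighbor.
    rcases hd u with h | ⟨x, hxC, hux⟩
    · exact absurd h hu
    · by_cases hvx : G.Adj v x
      · exact hs u v x huv hux hvx hu hv
      · exact ⟨x, hxC, fun h => hvx (h.1 hux)⟩

/-- Locating-dominating codes correspond under a covering that is injective on the vertices within
distance two of any vertex. -/
theorem isLDCode_preimage_iff {H : SimpleGraph W} {G : SimpleGraph V} {π : W → V}
    (hsurj : Function.Surjective π) (hmap : ∀ a b, H.Adj a b → G.Adj (π a) (π b))
    (hlift : ∀ a v, G.Adj (π a) v → ∃ b, H.Adj a b ∧ π b = v)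
    (hinj : ∀ y u x v z, H.Adj u y → H.Adj u x → H.Adj v x → H.Adj v z → π y = π z → y = z)
    (C : Set V) : IsLDCode H (π ⁻¹' C) ↔ IsLDCode G C := by
  rw [isLDCode_iff, isLDCode_iff]
  constructor
  · rintro ⟨hd, hs⟩
    constructor
    · intro v
      obtain ⟨a, rfl⟩ := hsurj v
      rcases hd a with h | ⟨w, hC, hw⟩
      · exact Or.inl h
      · exact Or.inr ⟨π w, hC, hmap _ _ hw⟩
    · intro u v x huv hux hvx hu hv
      -- The common neighbor is lifted first, so that the lifts of u and v share it and `hinj`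
      -- applies to their neighbors.
      obtain ⟨x', rfl⟩ := hsurj x
      obtain ⟨u', hu', rfl⟩ := hlift x' u hux.symm
      obtain ⟨v', hv', rfl⟩ := hlift x' v hvx.symm
      obtain ⟨y, hy, hyuv⟩ := hs u' v' x' (fun h => huv (h ▸ rfl)) hu'.symm hv'.symm hu hv
      refine ⟨π y, hy, fun h => hyuv ⟨fun h1 => ?_, fun h1 => ?_⟩⟩
      · obtain ⟨z, hz, hzy⟩ := hlift v' _ (h.1 (hmap _ _ h1))
        rwa [hinj y u' x' v' z h1 hu'.symm hv'.symm hz hzy.symm]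
      · obtain ⟨z, hz, hzy⟩ := hlift u' _ (h.2 (hmap _ _ h1))
        rwa [hinj y v' x' u' z h1 hv'.symm hu'.symm hz hzy.symm]
  · rintro ⟨hd, hs⟩
    constructor
    · intro v
      rcases hd (π v) with h | ⟨w, hC, hw⟩
      · exact Or.inl h
      · obtain ⟨b, hb, rfl⟩ := hlift v w hw
        exact Or.inr ⟨b, hC, hb⟩
    · intro u v x huv hux hvx hu hv
      -- The walk u, x, u, x, v is a degenerate instance of `hinj`.
      have hne : π u ≠ π v := fun h => huv
        (hinj u x u x v hux.symm hux.symm hux.symm hvx.symm h)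
      obtain ⟨y, hy, hyuv⟩ := hs _ _ _ hne (hmap _ _ hux) (hmap _ _ hvx) hu hv
      by_cases h : G.Adj (π u) y
      · obtain ⟨b, hb, rfl⟩ := hlift u y h
        exact ⟨b, hy, fun h' => hyuv ⟨fun _ => hmap _ _ (h'.1 hb), fun _ => h⟩⟩
      · have h2 : G.Adj (π v) y := by tauto
        obtain ⟨b, hb, rfl⟩ := hlift v y h2
        exact ⟨b, hy, fun h' => h (hmap _ _ (h'.2 hb))⟩

end Covering

/-! ### The circular strip as a quotient of the infinite strip -/

theorem squareGrid_adj_iff {i j k l : ℤ} : squareGrid.Adj (i, j) (k, l) ↔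
    (k = i ∧ (l = j + 1 ∨ l = j - 1)) ∨ (l = j ∧ (k = i + 1 ∨ k = i - 1)) := by
  change |i - k| + |j - l| = 1 ↔ _
  rcases abs_cases (i - k) with ⟨h1, h1'⟩ | ⟨h1, h1'⟩ <;>
    rcases abs_cases (j - l) with ⟨h2, h2'⟩ | ⟨h2, h2'⟩ <;> rw [h1, h2] <;> omega

theorem circularStrip_adj_iff {h s : ℕ} (hs : 5 ≤ s) (u v : stripVertices h s) :
    (circularStrip h s).Adj u v ↔
      (v.1.1 = u.1.1 ∧ (v.1.2 = u.1.2 + 1 ∨ v.1.2 = u.1.2 - 1 ∨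
        (u.1.2 = s ∧ v.1.2 = 1) ∨ (u.1.2 = 1 ∧ v.1.2 = s))) ∨
        (v.1.2 = u.1.2 ∧ (v.1.1 = u.1.1 + 1 ∨ v.1.1 = u.1.1 - 1)) := by
  rcases u with ⟨⟨i, j⟩, hu⟩
  rcases v with ⟨⟨k, l⟩, hv⟩
  have hj : 1 ≤ j ∧ j ≤ s := hu.2
  have hl : 1 ≤ l ∧ l ≤ s := hv.2
  rw [circularStrip, SimpleGraph.sup_adj, SimpleGraph.fromRel_adj]
  change squareGrid.Adj (i, j) (k, l) ∨ _ ↔ _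
  simp only [squareGrid_adj_iff, ne_eq, Subtype.mk.injEq, Prod.mk.injEq, true_or,
    and_true]
  clear hu hv
  constructor
  · omega
  · omega

/-- The projection of the infinite strip onto the circular strip. -/
def wrap (h s : ℕ) (hs : 5 ≤ s) (v : infiniteStripVertices h) : stripVertices h s :=
  ⟨(v.1.1, (v.1.2 - 1) % s + 1), by
    refine ⟨v.2, ?_⟩
    have h1 := Int.emod_nonneg (v.1.2 - 1) (b := (s : ℤ)) (by omega)
    have h2 := Int.emod_lt_of_pos (v.1.2 - 1) (b := (s : ℤ)) (by omega)
    exact ⟨by simpa using h1, by simpa using h2⟩⟩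

theorem eq_of_emod_eq_of_abs_sub_lt {a b n : ℤ} (h : a % n = b % n) (hab : |a - b| < n) :
    a = b := by
  have h1 : n ∣ a - b := Int.emod_eq_emod_iff_emod_sub_eq_zero.1 h |> Int.dvd_of_emod_eq_zero
  have := Int.eq_zero_of_abs_lt_dvd h1 hab
  omega

/-- The ends of a walk of length four differ by at most 4 in the column, so if their columns agree
modulo s ≥ 5 they are equal. This is the injectivity that the covering lemma asks for, and the
source of the bound 5. -/
theorem isLDCode_infiniteStrip_wrap_iff {h s : ℕ} (hs : 5 ≤ s) (C : Set (stripVertices h s)) :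
    IsLDCode (infiniteStrip h) (wrap h s hs ⁻¹' C) ↔ IsLDCode (circularStrip h s) C := by
  have hadj : ∀ a b : infiniteStripVertices h, (infiniteStrip h).Adj a b ↔
      (b.1.1 = a.1.1 ∧ (b.1.2 = a.1.2 + 1 ∨ b.1.2 = a.1.2 - 1)) ∨
        (b.1.2 = a.1.2 ∧ (b.1.1 = a.1.1 + 1 ∨ b.1.1 = a.1.1 - 1)) := by
    rintro ⟨⟨i, j⟩, ha⟩ ⟨⟨k, l⟩, hb⟩
    exact squareGrid_adj_iff
  have hmod : ∀ j : ℤ, 0 ≤ (j - 1) % s ∧ (j - 1) % s < s :=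
    fun j => ⟨Int.emod_nonneg _ (by omega), Int.emod_lt_of_pos _ (by omega)⟩
  -- Moving one column right or left, including the jump across the seam.
  have hmod1 : ∀ j : ℤ, (j + 1 - 1) % s =
      if (j - 1) % s + 1 = s then 0 else (j - 1) % s + 1 := by
    intro j
    have e := Int.emod_add_mul_ediv (j - 1) s
    have h1 := hmod j
    split_ifs with h2
    · rw [show j + 1 - 1 = s * ((j - 1) / s + 1) by rw [mul_add]; omega]
      exact Int.mul_emod_right _ _
    · rw [show j + 1 - 1 = ((j - 1) % s + 1) + s * ((j - 1) / s) by omega,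
        Int.add_mul_emod_self_left]
      exact Int.emod_eq_of_lt (by omega) (by omega)
  have hmod2 : ∀ j : ℤ, (j - 1 - 1) % s =
      if (j - 1) % s = 0 then (s : ℤ) - 1 else (j - 1) % s - 1 := by
    intro j
    have h1 := hmod1 (j - 1)
    rw [show j - 1 + 1 - 1 = j - 1 by ring] at h1
    have h2 := hmod (j - 1)
    split_ifs at h1 ⊢ <;> omega
  refine isLDCode_preimage_iff ?_ ?_ ?_ ?_ C
  · rintro ⟨⟨i, j⟩, hi, hj⟩
    refine ⟨⟨(i, j), hi⟩, Subtype.ext (Prod.ext rfl ?_)⟩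
    have hj1 : 1 ≤ j ∧ j ≤ s := hj
    change (j - 1) % s + 1 = j
    rw [Int.emod_eq_of_lt (by omega) (by omega)]
    ring
  · rintro ⟨⟨i, j⟩, ha⟩ ⟨⟨k, l⟩, hb⟩ hab
    rw [hadj] at hab
    rw [circularStrip_adj_iff hs]
    dsimp only [wrap] at hab ⊢
    have h1 := hmod j
    rcases hab with ⟨rfl, rfl | rfl⟩ | ⟨rfl, rfl | rfl⟩
    · rw [hmod1]; split_ifs <;> omega
    · rw [hmod2]; split_ifs <;> omega
    · omega
    · omega
  · rintro ⟨⟨i, j⟩, ha⟩ ⟨⟨k, l⟩, hk, hl⟩ hab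
    rw [circularStrip_adj_iff hs] at hab
    dsimp only [wrap] at hab
    have h1 := hmod j
    have h2 := hmod1 j
    have h3 := hmod2 j
    have hl' : 1 ≤ l ∧ l ≤ s := hl
    have goal : ∀ m : ℤ, ((k = i ∧ (m = j + 1 ∨ m = j - 1)) ∨
        (m = j ∧ (k = i + 1 ∨ k = i - 1))) → (m - 1) % s + 1 = l →
        ∃ b, (infiniteStrip h).Adj ⟨(i, j), ha⟩ b ∧ wrap h s hs b = ⟨(k, l), hk, hl⟩ :=
      fun m hm hml => ⟨⟨(k, m), hk⟩, (hadj _ _).2 hm, Subtype.ext (Prod.ext rfl hml)⟩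
    rcases hab with ⟨hki, hlj⟩ | ⟨hlj, hki⟩
    · by_cases hc : l = (j + 1 - 1) % s + 1
      · exact goal (j + 1) (by omega) hc.symm
      · refine goal (j - 1) (by omega) ?_
        split_ifs at h2 h3 <;> omega
    · exact goal j (by omega) hlj.symm
  · intro y u x v z h1 h2 h3 h4 h5
    rw [hadj] at h1 h2 h3 h4
    have e1 : y.1.1 = z.1.1 := congrArg (fun t => t.1.1) h5
    have e2 : (y.1.2 - 1) % s + 1 = (z.1.2 - 1) % s + 1 := congrArg (fun t => t.1.2) h5
    have e3 := eq_of_emod_eq_of_abs_sub_lt (a := y.1.2 - 1) (b := z.1.2 - 1) (n := s) (by omega)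
      (by rw [abs_lt]; omega)
    exact Subtype.ext (Prod.ext e1 (by omega))

/-! ### Codes given by columns -/

set_option maxHeartbeats 2000000 in
/-- A code is locating-dominating in the infinite strip iff every cell is dominated and any two
cells at distance two are separated. -/
theorem isLDCode_infiniteStrip_iff {h : ℕ} {P : Set (ℤ × ℤ)} {T : ℤ → ℤ → Prop}
    (hT : ∀ i j, T i j ↔ (1 ≤ i ∧ i ≤ h) ∧ (i, j) ∈ P) :
    IsLDCode (infiniteStrip h) (Subtype.val ⁻¹' P) ↔
      (∀ i j : ℤ, 1 ≤ i → i ≤ h → T i j ∨ T (i - 1) j ∨ T (i + 1) j ∨ T i (j - 1) ∨ T i (j + 1)) ∧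
      (∀ i j : ℤ, 1 ≤ i → i ≤ h → T i j ∨ T i (j + 2) ∨ T (i - 1) j ∨ T (i + 1) j ∨ T i (j - 1) ∨
        T (i - 1) (j + 2) ∨ T (i + 1) (j + 2) ∨ T i (j + 3)) ∧
      (∀ i j : ℤ, 1 ≤ i → i + 1 ≤ h → T i j ∨ T (i + 1) (j + 1) ∨ T (i - 1) j ∨ T i (j - 1) ∨
        T (i + 2) (j + 1) ∨ T (i + 1) (j + 2)) ∧
      (∀ i j : ℤ, 1 ≤ i → i + 1 ≤ h → T (i + 1) j ∨ T i (j + 1) ∨ T (i + 2) j ∨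
        T (i + 1) (j - 1) ∨ T (i - 1) (j + 1) ∨ T i (j + 2)) ∧
      (∀ i j : ℤ, 1 ≤ i → i + 2 ≤ h → T i j ∨ T (i + 2) j ∨ T (i - 1) j ∨ T i (j - 1) ∨
        T i (j + 1) ∨ T (i + 3) j ∨ T (i + 2) (j - 1) ∨ T (i + 2) (j + 1)) := by
  -- `T` is false outside the rows 1, …, h, so the clauses may name cells above or below the strip.
  have hb : ∀ {i j}, T i j → 1 ≤ i ∧ i ≤ h := fun t => ((hT _ _).1 t).1
  have hadj : ∀ a b : infiniteStripVertices h, (infiniteStrip h).Adj a b ↔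
      squareGrid.Adj (a.1.1, a.1.2) (b.1.1, b.1.2) := fun a b => Iff.rfl
  have hmem : ∀ a : infiniteStripVertices h,
      a ∈ Subtype.val ⁻¹' P ↔ T a.1.1 a.1.2 := fun a => by
    rw [hT]; exact ⟨fun t => ⟨a.2, t⟩, fun t => t.2⟩
  rw [isLDCode_iff]
  constructor
  · rintro ⟨hd, hs⟩
    have sep : ∀ i j k l m n : ℤ, 1 ≤ i → i ≤ h → 1 ≤ k → k ≤ h → 1 ≤ m → m ≤ h →
        (i ≠ k ∨ j ≠ l) → squareGrid.Adj (i, j) (m, n) → squareGrid.Adj (k, l) (m, n) →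
        ¬ T i j → ¬ T k l →
        ∃ p q, T p q ∧ ¬ (squareGrid.Adj (i, j) (p, q) ↔ squareGrid.Adj (k, l) (p, q)) := by
      intro i j k l m n hi1 hi2 hk1 hk2 hm1 hm2 hne h1 h2 h3 h4
      obtain ⟨y, hy, hy'⟩ := hs ⟨(i, j), hi1, hi2⟩ ⟨(k, l), hk1, hk2⟩ ⟨(m, n), hm1, hm2⟩
        (fun e => by
          have e' := congrArg Subtype.val e
          simp only [Prod.mk.injEq] at e'
          omega) h1 h2 (fun t => h3 ((hmem _).1 t)) (fun t => h4 ((hmem _).1 t))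
      exact ⟨y.1.1, y.1.2, (hmem _).1 hy, hy'⟩
    -- A separating codeword lies in exactly one of the two neighborhoods; this is why the clauses
    -- omit the common neighbors of the pair.
    have res : ∀ i j k l m n : ℤ, 1 ≤ i → i ≤ h → 1 ≤ k → k ≤ h → 1 ≤ m → m ≤ h →
        (i ≠ k ∨ j ≠ l) → squareGrid.Adj (i, j) (m, n) → squareGrid.Adj (k, l) (m, n) →
        T i j ∨ T k l ∨ ∃ p q, T p q ∧
          ((((p = i ∧ (q = j + 1 ∨ q = j - 1)) ∨ (q = j ∧ (p = i + 1 ∨ p = i - 1))) ∧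
            ¬ ((p = k ∧ (q = l + 1 ∨ q = l - 1)) ∨ (q = l ∧ (p = k + 1 ∨ p = k - 1)))) ∨
          (((p = k ∧ (q = l + 1 ∨ q = l - 1)) ∨ (q = l ∧ (p = k + 1 ∨ p = k - 1))) ∧
            ¬ ((p = i ∧ (q = j + 1 ∨ q = j - 1)) ∨ (q = j ∧ (p = i + 1 ∨ p = i - 1))))) := by
      intro i j k l m n hi1 hi2 hk1 hk2 hm1 hm2 hne h1 h2
      by_cases c1 : T i j
      · exact Or.inl c1
      by_cases c2 : T k l
      · exact Or.inr (Or.inl c2)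
      obtain ⟨p, q, hpq, hn⟩ := sep i j k l m n hi1 hi2 hk1 hk2 hm1 hm2 hne h1 h2 c1 c2
      rw [squareGrid_adj_iff, squareGrid_adj_iff] at hn
      exact Or.inr (Or.inr ⟨p, q, hpq, (xor_iff_not_iff _ _).2 hn⟩)
    refine ⟨?_, ?_, ?_, ?_, ?_⟩
    · intro i j h1 h2
      rcases hd ⟨(i, j), h1, h2⟩ with t | ⟨w, hw, t⟩
      · exact Or.inl ((hmem _).1 t)
      · rw [hmem] at hw
        rw [hadj, squareGrid_adj_iff] at t
        rcases t with ⟨e1, e2 | e2⟩ | ⟨e1, e2 | e2⟩ <;> rw [e1, e2] at hw <;> simp [hw]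
    · intro i j h1 h2
      rcases res i j i (j + 2) i (j + 1) h1 h2 h1 h2 h1 h2 (by omega)
        (squareGrid_adj_iff.2 (by omega)) (squareGrid_adj_iff.2 (by omega)) with
        t | t | ⟨p, q, hw, t⟩
      · simp [t]
      · simp [t]
      · rcases t with ⟨⟨e1, e2 | e2⟩ | ⟨e2, e1 | e1⟩, t⟩ | ⟨⟨e1, e2 | e2⟩ | ⟨e2, e1 | e1⟩, t⟩ <;>
          first
          | exact absurd (by omega) t
          | (rw [e1, e2] at hw
             try simp only [add_assoc] at hw
             try norm_num only at hw
             simp [hw])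
    · intro i j h1 h2
      rcases res i j (i + 1) (j + 1) (i + 1) j h1 (by omega) (by omega) h2 (by omega) h2 (by omega)
        (squareGrid_adj_iff.2 (by omega)) (squareGrid_adj_iff.2 (by omega)) with
        t | t | ⟨p, q, hw, t⟩
      · simp [t]
      · simp [t]
      · rcases t with ⟨⟨e1, e2 | e2⟩ | ⟨e2, e1 | e1⟩, t⟩ | ⟨⟨e1, e2 | e2⟩ | ⟨e2, e1 | e1⟩, t⟩ <;>
          first
          | exact absurd (by omega) t
          | (rw [e1, e2] at hw
             try simp only [add_assoc] at hw
             try norm_num only at hw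
             simp [hw])
    · intro i j h1 h2
      rcases res (i + 1) j i (j + 1) i j (by omega) h2 h1 (by omega) h1 (by omega) (by omega)
        (squareGrid_adj_iff.2 (by omega)) (squareGrid_adj_iff.2 (by omega)) with
        t | t | ⟨p, q, hw, t⟩
      · simp [t]
      · simp [t]
      · rcases t with ⟨⟨e1, e2 | e2⟩ | ⟨e2, e1 | e1⟩, t⟩ | ⟨⟨e1, e2 | e2⟩ | ⟨e2, e1 | e1⟩, t⟩ <;>
          first
          | exact absurd (by omega) t
          | (rw [e1, e2] at hw
             try simp only [add_assoc] at hw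
             try norm_num only at hw
             simp [hw])
    · intro i j h1 h2
      rcases res i j (i + 2) j (i + 1) j h1 (by omega) (by omega) h2 (by omega) (by omega)
        (by omega) (squareGrid_adj_iff.2 (by omega)) (squareGrid_adj_iff.2 (by omega)) with
        t | t | ⟨p, q, hw, t⟩
      · simp [t]
      · simp [t]
      · rcases t with ⟨⟨e1, e2 | e2⟩ | ⟨e2, e1 | e1⟩, t⟩ | ⟨⟨e1, e2 | e2⟩ | ⟨e2, e1 | e1⟩, t⟩ <;>
          first
          | exact absurd (by omega) t
          | (rw [e1, e2] at hw
             try simp only [add_assoc] at hw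
             try norm_num only at hw
             simp [hw])
  · rintro ⟨hd, hh, hdiag, hanti, hv⟩
    constructor
    · rintro ⟨⟨i, j⟩, hi⟩
      have w : ∀ k l, T k l → squareGrid.Adj (i, j) (k, l) →
          ∃ w ∈ Subtype.val ⁻¹' P, (infiniteStrip h).Adj ⟨(i, j), hi⟩ w :=
        fun k l t e => ⟨⟨(k, l), hb t⟩, (hmem _).2 t, e⟩
      rcases hd i j hi.1 hi.2 with t | t | t | t | t
      · exact Or.inl ((hmem _).2 t)
      all_goals exact Or.inr (w _ _ t (squareGrid_adj_iff.2 (by omega)))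
    · have sep : ∀ i j k l : ℤ, 1 ≤ i → i ≤ h → 1 ≤ k → k ≤ h → ¬ T i j → ¬ T k l →
          ((k = i ∧ l = j + 2) ∨ (k = i + 1 ∧ l = j + 1) ∨ (k = i - 1 ∧ l = j + 1) ∨
            (k = i + 2 ∧ l = j)) →
          ∃ p q, T p q ∧ ¬ (squareGrid.Adj (i, j) (p, q) ↔ squareGrid.Adj (k, l) (p, q)) := by
        intro i j k l hi1 hi2 hk1 hk2 h1 h2 hc
        have w : ∀ p q, T p q → ¬ (((p = i ∧ (q = j + 1 ∨ q = j - 1)) ∨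
            (q = j ∧ (p = i + 1 ∨ p = i - 1))) ↔ ((p = k ∧ (q = l + 1 ∨ q = l - 1)) ∨
            (q = l ∧ (p = k + 1 ∨ p = k - 1)))) →
            ∃ p q, T p q ∧ ¬ (squareGrid.Adj (i, j) (p, q) ↔ squareGrid.Adj (k, l) (p, q)) := by
          intro p q hp hpq
          exact ⟨p, q, hp, by rwa [squareGrid_adj_iff, squareGrid_adj_iff]⟩
        rcases hc with ⟨rfl, rfl⟩ | ⟨rfl, rfl⟩ | ⟨rfl, rfl⟩ | ⟨rfl, rfl⟩
        · rcases hh k j hk1 hk2 with t | t | t | t | t | t | t | t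
          · exact absurd t h1
          · exact absurd t h2
          all_goals exact w _ _ t (by omega)
        · rcases hdiag i j hi1 hk2 with t | t | t | t | t | t
          · exact absurd t h1
          · exact absurd t h2
          all_goals exact w _ _ t (by omega)
        · rcases hanti (i - 1) j hk1 (by omega) with t | t | t | t | t | t
          · exact absurd (by rwa [sub_add_cancel] at t) h1
          · exact absurd t h2
          all_goals exact w _ _ t (by omega)
        · rcases hv i l hi1 hk2 with t | t | t | t | t | t | t | t
          · exact absurd t h1
          · exact absurd t h2
          all_goals exact w _ _ t (by omega)
      rintro ⟨⟨i, j⟩, hi⟩ ⟨⟨k, l⟩, hk⟩ ⟨⟨m, n⟩, hm⟩ hne h1 h2 h3 h4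
      have hne' : i ≠ k ∨ j ≠ l := by
        by_contra! e
        exact hne (Subtype.ext (Prod.ext e.1 e.2))
      rw [hadj, squareGrid_adj_iff] at h1 h2
      rw [hmem] at h3 h4
      dsimp only at h1 h2 h3 h4
      -- Up to order, distinct cells with a common neighbor differ by one of four vectors.
      have hc : ((k = i ∧ l = j + 2) ∨ (k = i + 1 ∧ l = j + 1) ∨ (k = i - 1 ∧ l = j + 1) ∨
            (k = i + 2 ∧ l = j)) ∨ ((i = k ∧ j = l + 2) ∨ (i = k + 1 ∧ j = l + 1) ∨
            (i = k - 1 ∧ j = l + 1) ∨ (i = k + 2 ∧ j = l)) := by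
        clear hd hh hdiag hanti hv hT hb hadj hmem sep hne h3 h4 hi hk hm
        rcases h1 with ⟨e1, e2 | e2⟩ | ⟨e2, e1 | e1⟩ <;>
          rcases h2 with ⟨e3, e4 | e4⟩ | ⟨e4, e3 | e3⟩ <;> subst e1 e2 <;> omega
      rcases hc with hc | hc
      · obtain ⟨p, q, hp, hpq⟩ := sep i j k l hi.1 hi.2 hk.1 hk.2 h3 h4 hc
        exact ⟨⟨(p, q), hb hp⟩, (hmem _).2 hp, hpq⟩
      · obtain ⟨p, q, hp, hpq⟩ := sep k l i j hk.1 hk.2 hi.1 hi.2 h4 h3 hc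
        exact ⟨⟨(p, q), hb hp⟩, (hmem _).2 hp, fun e => hpq e.symm⟩

/-- The cell `(i, j)` of the code with columns `f` is bit `i - 1` of `f j`. -/
def bitCode (f : ℤ → ℕ) : Set (ℤ × ℤ) := {v | 1 ≤ v.1 ∧ (f v.2).testBit (v.1 - 1).toNat}

theorem mem_Icc_of_mem_bitCode {h : ℕ} {f : ℤ → ℕ} (hf : ∀ j, f j < 2 ^ h) {i j : ℤ}
    (hij : (i, j) ∈ bitCode f) : i ∈ Set.Icc (1 : ℤ) h := by
  refine ⟨hij.1, ?_⟩
  by_contra hc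
  have := hij.2
  rw [Nat.testBit_lt_two_pow ((hf j).trans_le (Nat.pow_le_pow_right (by norm_num)
    (show h ≤ (i - 1).toNat by omega)))] at this
  exact absurd this (by simp)

/-- The first `m` bits of `x` are set. -/
def covers (m x : ℕ) : Bool := x % 2 ^ m == 2 ^ m - 1

theorem covers_iff {m x : ℕ} : covers m x = true ↔ ∀ k < m, x.testBit k = true := by
  rw [covers, beq_iff_eq]
  constructor
  · intro e k hk
    have := congrArg (fun y => y.testBit k) e
    simpa [Nat.testBit_mod_two_pow, Nat.testBit_two_pow_sub_one, hk] using this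
  · intro e
    apply Nat.eq_of_testBit_eq
    intro k
    rw [Nat.testBit_mod_two_pow, Nat.testBit_two_pow_sub_one]
    by_cases hk : k < m
    · simp [hk, e k hk]
    · simp [hk]

/-- With neighboring columns `a` and `c`, the cells of column `b` are dominated and separated from
each other. -/
def columnOK (h a b c : ℕ) : Bool :=
  covers h (b ||| b <<< 1 ||| b >>> 1 ||| a ||| c) &&
    covers (h - 2) (b ||| b >>> 2 ||| b <<< 1 ||| a ||| c ||| b >>> 3 ||| a >>> 2 ||| c >>> 2)

/-- In the consecutive columns `a, b, c, d`, the cells of `b` and `c` are separated. -/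
def diagonalOK (h a b c d : ℕ) : Bool :=
  covers (h - 1) (b ||| c >>> 1 ||| b <<< 1 ||| a ||| c >>> 2 ||| d >>> 1) &&
    covers (h - 1) (b >>> 1 ||| c ||| b >>> 2 ||| a >>> 1 ||| c <<< 1 ||| d)

/-- In the consecutive columns `a, b, c, d, e`, the cells of `b` and `d` are separated. -/
def rowOK (h a b d e : ℕ) : Bool :=
  covers h (b ||| d ||| b <<< 1 ||| b >>> 1 ||| a ||| d <<< 1 ||| d >>> 1 ||| e)

/-- The local conditions on five consecutive columns of a locating-dominating code. -/
def windowOK (h a b c d e : ℕ) : Bool :=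
  columnOK h a b c && diagonalOK h a b c d && rowOK h a b d e

/-- Rows count from 1 and bits from 0. Here m is the vertical extent of a pair of cells; truncated
subtraction leaves no condition when the pair does not fit. -/
theorem forall_row_iff {h : ℕ} {p : ℤ → Prop} (m : ℕ) :
    (∀ i : ℤ, 1 ≤ i → i + m ≤ h → p i) ↔ ∀ k : ℕ, k < h - m → p (k + 1) := by
  constructor
  · intro H k hk
    exact H _ (by omega) (by omega)
  · intro H i h1 h2
    have := H (i - 1).toNat (by omega)
    rwa [show (((i - 1).toNat : ℤ)) + 1 = i by omega] at this

theorem isLDCode_bitCode_iff {h : ℕ} {f : ℤ → ℕ} (hf : ∀ j, f j < 2 ^ h) :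
    IsLDCode (infiniteStrip h) (Subtype.val ⁻¹' bitCode f) ↔
      ∀ j, windowOK h (f j) (f (j + 1)) (f (j + 2)) (f (j + 3)) (f (j + 4)) = true := by
  set T : ℤ → ℤ → Prop := fun i j => 1 ≤ i ∧ (f j).testBit (i - 1).toNat with hTdef
  have hT : ∀ i j, T i j ↔ (1 ≤ i ∧ i ≤ h) ∧ (i, j) ∈ bitCode f := by
    intro i j
    exact ⟨fun t => ⟨mem_Icc_of_mem_bitCode hf t, t⟩, fun t => t.2⟩
  have t0 : ∀ (k : ℕ) j, T (k + 1) j ↔ (f j).testBit k := by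
    intro k j
    simp only [hTdef, add_sub_cancel_right, Int.toNat_natCast]
    exact and_iff_right (by omega)
  have tm : ∀ (k : ℕ) j, T k j ↔ (1 ≤ k ∧ (f j).testBit (k - 1)) := by
    intro k j
    simp only [hTdef]
    rw [show ((k : ℤ) - 1).toNat = k - 1 by omega]
    exact and_congr_left' (by omega)
  have t1 : ∀ (k : ℕ) j, T (k + 2) j ↔ (f j).testBit (1 + k) := by
    intro k j
    rw [← t0]; push_cast; ring_nf
  have t2 : ∀ (k : ℕ) j, T (k + 3) j ↔ (f j).testBit (2 + k) := by
    intro k j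
    rw [← t0]; push_cast; ring_nf
  have t3 : ∀ (k : ℕ) j, T (k + 4) j ↔ (f j).testBit (3 + k) := by
    intro k j
    rw [← t0]; push_cast; ring_nf
  -- The clauses reach one column to the left of j; starting them at j + 1 makes `f j` the first
  -- column of the window.
  have shift : ∀ {q : ℤ → Prop} (m : ℤ), (∀ j, q j) ↔ ∀ j, q (j + m) :=
    fun m => ⟨fun H j => H _, fun H j => by simpa using H (j - m)⟩
  rw [isLDCode_infiniteStrip_iff hT]
  have e0 := fun (p : ℤ → Prop) => forall_row_iff (h := h) (p := p) 0
  have e1 := fun (p : ℤ → Prop) => forall_row_iff (h := h) (p := p) 1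
  have e2 := fun (p : ℤ → Prop) => forall_row_iff (h := h) (p := p) 2
  simp only [Nat.cast_zero, add_zero, Nat.sub_zero] at e0
  simp only [Nat.cast_one] at e1
  simp only [Nat.cast_ofNat] at e2
  simp only [windowOK, columnOK, diagonalOK, rowOK, Bool.and_eq_true, covers_iff, forall_and,
    Nat.testBit_or, Nat.testBit_shiftLeft, Nat.testBit_shiftRight, Bool.or_eq_true,
    decide_eq_true_eq]
  have c1 : ∀ {q : ℤ → ℤ → Prop}, (∀ i j : ℤ, 1 ≤ i → i ≤ h → q i j) ↔
      ∀ j, ∀ k : ℕ, k < h → q (k + 1) (j + 1) := by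
    intro q
    rw [forall_comm, shift 1]
    exact forall_congr' fun j => e0 _
  have c2 : ∀ {q : ℤ → ℤ → Prop}, (∀ i j : ℤ, 1 ≤ i → i + 1 ≤ h → q i j) ↔
      ∀ j, ∀ k : ℕ, k < h - 1 → q (k + 1) (j + 1) := by
    intro q
    rw [forall_comm, shift 1]
    exact forall_congr' fun j => e1 _
  have c3 : ∀ {q : ℤ → ℤ → Prop}, (∀ i j : ℤ, 1 ≤ i → i + 2 ≤ h → q i j) ↔
      ∀ j, ∀ k : ℕ, k < h - 2 → q (k + 1) (j + 1) := by
    intro q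
    rw [forall_comm, shift 1]
    exact forall_congr' fun j => e2 _
  rw [c1, c1, c2, c2, c3]
  simp only [add_sub_cancel_right, add_assoc]
  norm_num only
  simp only [t0, tm, t1, t2, t3, ge_iff_le, or_assoc]
  tauto

/-! ### Every code is given by columns -/

/-- The columns of `P` in the rows `1, …, h`. -/
noncomputable def columns (h : ℕ) (P : Set (ℤ × ℤ)) (j : ℤ) : ℕ :=
  open Classical in Nat.ofBits fun k : Fin h => decide (((k : ℤ) + 1, j) ∈ P)

theorem columns_lt (h : ℕ) (P : Set (ℤ × ℤ)) (j : ℤ) : columns h P j < 2 ^ h :=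
  Nat.ofBits_lt_two_pow _

theorem preimage_bitCode_columns (h : ℕ) (P : Set (ℤ × ℤ)) :
    (Subtype.val ⁻¹' bitCode (columns h P) : Set (infiniteStripVertices h)) =
      Subtype.val ⁻¹' P := by
  ext ⟨⟨i, j⟩, hi⟩
  have hi' : 1 ≤ i ∧ i ≤ h := hi
  have hk : (i - 1).toNat < h := by omega
  change (1 ≤ i ∧ (columns h P j).testBit (i - 1).toNat) ↔ (i, j) ∈ P
  rw [columns, Nat.testBit_ofBits_lt _ _ hk]
  simp only [decide_eq_true_eq]
  rw [show (((i - 1).toNat : ℕ) : ℤ) + 1 = i by omega]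
  exact and_iff_right hi'.1

/-- A column sequence of period n is constant on the fibers of `wrap`. -/
theorem bitCode_wrap {h n : ℕ} (hn : 5 ≤ n) {f : ℤ → ℕ} (hper : Function.Periodic f (n : ℤ)) :
    wrap h n hn ⁻¹' (Subtype.val ⁻¹' bitCode f) = Subtype.val ⁻¹' bitCode f := by
  ext ⟨⟨i, j⟩, hi⟩
  have : f ((j - 1) % n + 1) = f j := by
    have e := Int.emod_add_mul_ediv (j - 1) n
    rw [← hper.sub_zsmul_eq ((j - 1) / n) (x := j)]
    congr 1
    rw [smul_eq_mul, mul_comm]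
    omega
  change (1 ≤ i ∧ (f ((j - 1) % n + 1)).testBit (i - 1).toNat) ↔
    (1 ≤ i ∧ (f j).testBit (i - 1).toNat)
  rw [this]

theorem isLDCode_circularStrip_bitCode_iff {h n : ℕ} (hn : 5 ≤ n) {f : ℤ → ℕ}
    (hf : ∀ j, f j < 2 ^ h) (hper : Function.Periodic f (n : ℤ)) :
    IsLDCode (circularStrip h n) (Subtype.val ⁻¹' bitCode f) ↔
      ∀ j, windowOK h (f j) (f (j + 1)) (f (j + 2)) (f (j + 3)) (f (j + 4)) = true := by
  rw [← isLDCode_infiniteStrip_wrap_iff hn, bitCode_wrap hn hper, isLDCode_bitCode_iff hf]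

/-- Unroll the circular code along `wrap` and read off its columns. -/
theorem exists_bitCode {h n : ℕ} (hn : 5 ≤ n) (C : Set (stripVertices h n)) :
    ∃ f : ℤ → ℕ, (∀ j, f j < 2 ^ h) ∧ Function.Periodic f (n : ℤ) ∧
      Subtype.val ⁻¹' bitCode f = C := by
  set P : Set (ℤ × ℤ) := Subtype.val '' (wrap h n hn ⁻¹' C) with hP
  have hmem : ∀ v : infiniteStripVertices h, v.1 ∈ P ↔ wrap h n hn v ∈ C := fun v => by
    rw [hP, Subtype.val_injective.mem_set_image]; rfl
  have hper : Function.Periodic (columns h P) (n : ℤ) := by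
    intro j
    unfold columns
    congr 1
    funext k
    congr 1
    have hk : ∀ l : ℤ, (((k : ℕ) : ℤ) + 1, l) ∈ infiniteStripVertices h := fun l => by
      constructor <;> simp only <;> omega
    rw [hmem ⟨_, hk _⟩, hmem ⟨_, hk _⟩]
    have : wrap h n hn ⟨_, hk (j + n)⟩ = wrap h n hn ⟨_, hk j⟩ := by
      refine Subtype.ext (Prod.ext rfl ?_)
      change (j + n - 1) % n + 1 = (j - 1) % n + 1
      rw [show j + n - 1 = j - 1 + n by ring, Int.add_emod_right]
    rw [this]
  refine ⟨columns h P, columns_lt h P, hper, ?_⟩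
  have key : wrap h n hn ⁻¹' (Subtype.val ⁻¹' bitCode (columns h P)) = wrap h n hn ⁻¹' C := by
    rw [bitCode_wrap hn hper, preimage_bitCode_columns]
    exact Set.preimage_image_eq _ Subtype.val_injective
  ext ⟨⟨i, j⟩, hi, hj⟩
  have hj' : 1 ≤ j ∧ j ≤ n := hj
  have e : wrap h n hn ⟨(i, j), hi⟩ = ⟨(i, j), hi, hj⟩ := by
    refine Subtype.ext (Prod.ext rfl ?_)
    change (j - 1) % n + 1 = j
    rw [Int.emod_eq_of_lt (by omega) (by omega)]
    ring
  rw [← e]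
  exact Set.ext_iff.1 key ⟨(i, j), hi⟩

/-! ### Counting -/

/-- The number of the first `h` bits of `c` that are set. -/
def pop (h c : ℕ) : ℕ := (List.range h).countP c.testBit

theorem pop_le (h c : ℕ) : pop h c ≤ h :=
  (List.countP_le_length).trans_eq (by simp)

theorem pop_eq_card (h c : ℕ) : pop h c = ((Finset.range h).filter fun k => c.testBit k).card := by
  rw [pop, Finset.card_def, Finset.filter_val, ← Multiset.countP_eq_card_filter, Finset.range_val,
    Multiset.range, Multiset.coe_countP]
  simp

theorem ncard_bitCode_column {h : ℕ} {f : ℤ → ℕ} (hf : ∀ j, f j < 2 ^ h) (j : ℤ) :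
    {v : ℤ × ℤ | v ∈ bitCode f ∧ v.2 = j}.Finite ∧
      {v : ℤ × ℤ | v ∈ bitCode f ∧ v.2 = j}.ncard = pop h (f j) := by
  have hinj : Function.Injective fun k : ℕ => ((k : ℤ) + 1, j) := fun a b e => by
    simpa using e
  have : {v : ℤ × ℤ | v ∈ bitCode f ∧ v.2 = j} =
      (fun k : ℕ => ((k : ℤ) + 1, j)) '' ((Finset.range h).filter fun k => (f j).testBit k) := by
    ext ⟨i, l⟩
    simp only [Set.mem_ofPred_eq, Set.mem_image, Finset.coe_filter, Finset.mem_range, Prod.mk.injEq,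
      bitCode]
    constructor
    · rintro ⟨⟨h1, h2⟩, rfl⟩
      refine ⟨(i - 1).toNat, ⟨?_, h2⟩, by omega, rfl⟩
      have := (mem_Icc_of_mem_bitCode hf (i := i) (j := l) ⟨h1, h2⟩).2
      omega
    · rintro ⟨k, ⟨-, h2⟩, rfl, rfl⟩
      exact ⟨⟨by omega, by simpa using h2⟩, rfl⟩
  rw [this]
  refine ⟨Set.toFinite _, ?_⟩
  rw [Set.ncard_image_of_injective _ hinj, Set.ncard_coe_finset, pop_eq_card]

/-- Finiteness is carried through the induction because the cardinality of a disjoint union needs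
it. -/
theorem ncard_bitCode {h : ℕ} {f : ℤ → ℕ} (hf : ∀ j, f j < 2 ^ h) (a : ℤ) (n : ℕ) :
    {v : ℤ × ℤ | v ∈ bitCode f ∧ a ≤ v.2 ∧ v.2 < a + n}.Finite ∧
      {v : ℤ × ℤ | v ∈ bitCode f ∧ a ≤ v.2 ∧ v.2 < a + n}.ncard =
        ∑ t ∈ Finset.range n, pop h (f (a + t)) := by
  induction n with
  | zero =>
    have : {v : ℤ × ℤ | v ∈ bitCode f ∧ a ≤ v.2 ∧ v.2 < a + (0 : ℕ)} = ∅ := by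
      ext v
      simp only [Set.mem_ofPred_eq, Set.mem_empty_iff_false, iff_false]
      omega
    rw [this]
    simp
  | succ n ih =>
    obtain ⟨hfin, hcard⟩ := ncard_bitCode_column hf (a + n)
    have : {v : ℤ × ℤ | v ∈ bitCode f ∧ a ≤ v.2 ∧ v.2 < a + (n + 1 : ℕ)} =
        {v : ℤ × ℤ | v ∈ bitCode f ∧ a ≤ v.2 ∧ v.2 < a + n} ∪
          {v : ℤ × ℤ | v ∈ bitCode f ∧ v.2 = a + n} := by
      ext v
      simp only [Set.mem_ofPred_eq, Set.mem_union, ← and_or_left]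
      exact and_congr_right fun _ => by omega
    rw [this]
    refine ⟨ih.1.union hfin, ?_⟩
    rw [Set.ncard_union_eq _ ih.1 hfin, ih.2, hcard, Finset.sum_range_succ]
    rw [Set.disjoint_left]
    rintro v ⟨-, -, h1⟩ ⟨-, h2⟩
    omega

theorem ncard_circularStrip_bitCode {h : ℕ} {f : ℤ → ℕ} (hf : ∀ j, f j < 2 ^ h) (n : ℕ) :
    (Subtype.val ⁻¹' bitCode f : Set (stripVertices h n)).ncard =
      ∑ t ∈ Finset.range n, pop h (f (1 + t)) := by
  rw [← (ncard_bitCode hf 1 n).2, ← Set.ncard_image_of_injective _ Subtype.val_injective,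
    Subtype.image_preimage_coe]
  congr 1
  ext ⟨i, j⟩
  constructor
  · rintro ⟨⟨-, h1, h2⟩, h3⟩
    exact ⟨h3, h1, by have : j ≤ n := h2; change j < 1 + n; omega⟩
  · rintro ⟨h3, h1, h2⟩
    exact ⟨⟨mem_Icc_of_mem_bitCode hf h3, h1, by have : j < 1 + n := h2; change j ≤ n; omega⟩, h3⟩

theorem ncard_window_bitCode {h : ℕ} {f : ℤ → ℕ} (hf : ∀ j, f j < 2 ^ h) (m : ℕ) :
    (Subtype.val ⁻¹' bitCode f ∩ window h m).ncard =
      ∑ t ∈ Finset.range (2 * m + 1), pop h (f (-m + t)) := by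
  rw [← (ncard_bitCode hf (-m) (2 * m + 1)).2,
    ← Set.ncard_image_of_injective _ Subtype.val_injective]
  congr 1
  ext ⟨i, j⟩
  constructor
  · rintro ⟨⟨v, hv⟩, ⟨h1, h2⟩, rfl⟩
    have h3 : |j| ≤ m := h2
    rw [abs_le] at h3
    refine ⟨h1, h3.1, ?_⟩
    change j < -m + ((2 * m + 1 : ℕ) : ℤ)
    omega
  · rintro ⟨h1, h2, h3⟩
    have h2' : -(m : ℤ) ≤ j := h2
    have h3' : j < -m + ((2 * m + 1 : ℕ) : ℤ) := h3
    refine ⟨⟨(i, j), mem_Icc_of_mem_bitCode hf h1⟩, ⟨h1, ?_⟩, rfl⟩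
    change |j| ≤ m
    rw [abs_le]
    omega

theorem ncard_window (h m : ℕ) : (window h m).ncard = h * (2 * m + 1) := by
  have hlt : ∀ _ : ℤ, 2 ^ h - 1 < 2 ^ h := fun _ => Nat.sub_lt (by positivity) one_pos
  -- With all h bits set in each column the code is the whole strip, so counting codes also counts
  -- the window.
  have e : (Subtype.val ⁻¹' bitCode (fun _ => 2 ^ h - 1) : Set (infiniteStripVertices h)) =
      Set.univ := by
    ext ⟨⟨i, j⟩, hi⟩
    have hi' : 1 ≤ i ∧ i ≤ h := hi
    simp only [Set.mem_preimage, bitCode, Set.mem_ofPred_eq, Nat.testBit_two_pow_sub_one,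
      decide_eq_true_eq, Set.mem_univ, iff_true]
    omega
  have := ncard_window_bitCode hlt m
  rw [e, Set.univ_inter] at this
  rw [this, Finset.sum_const, Finset.card_range, pop_eq_card, Finset.filter_true_of_mem]
  · simp [mul_comm]
  · intro k hk
    simpa [Nat.testBit_two_pow_sub_one] using hk

theorem card_stripVertices (h n : ℕ) : Nat.card (stripVertices h n) = h * n := by
  rw [Nat.card_coe_set_eq, stripVertices, Set.ncard_prod]
  simp [Set.ncard_eq_toFinset_card']

/-! ### Potentials -/

section Potential

variable {x g : ℤ → ℕ} {D N : ℕ}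

theorem sum_range_add_eq_of_periodic {n : ℕ} (hx : Function.Periodic x (n : ℤ)) (a b : ℤ) :
    ∑ t ∈ Finset.range n, x (a + t) = ∑ t ∈ Finset.range n, x (b + t) := by
  have step : ∀ a : ℤ, ∑ t ∈ Finset.range n, x (a + 1 + t) = ∑ t ∈ Finset.range n, x (a + t) := by
    intro a
    have h1 := Finset.sum_range_succ (fun t : ℕ => x (a + t)) n
    have h2 := Finset.sum_range_succ' (fun t : ℕ => x (a + t)) n
    simp only [hx a, Nat.cast_zero, add_zero] at h1 h2
    rw [h1] at h2
    have h3 := Nat.add_right_cancel h2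
    rw [h3]
    refine Finset.sum_congr rfl fun t _ => ?_
    push_cast
    ring_nf
  have zero : ∀ a : ℤ, ∑ t ∈ Finset.range n, x (a + t) = ∑ t ∈ Finset.range n, x (0 + t) := by
    intro a
    induction a using Int.induction_on with
    | zero => rfl
    | succ a ih => rw [step, ih]
    | pred a ih => rw [← step, sub_add_cancel, ih]
  rw [zero a, zero b]

/-- Telescoping: the differences of g cancel except at the two ends. Around a period the ends cancel
as well. -/
theorem mul_add_potential_le (hs : ∀ j, N + g (j + 1) ≤ D * x j + g j) (a : ℤ) (n : ℕ) :
    N * n + g (a + n) ≤ D * ∑ t ∈ Finset.range n, x (a + t) + g a := by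
  induction n with
  | zero => simp
  | succ n ih =>
    have := hs (a + n)
    rw [Finset.sum_range_succ, mul_add, mul_add]
    push_cast
    rw [← add_assoc]
    omega

theorem mul_le_of_periodic (hs : ∀ j, N + g (j + 1) ≤ D * x j + g j) {n : ℕ}
    (hg : Function.Periodic g (n : ℤ)) (a : ℤ) :
    N * n ≤ D * ∑ t ∈ Finset.range n, x (a + t) := by
  have := mul_add_potential_le hs a n
  rw [hg a] at this
  omega

/-- If the bound of `mul_le_of_periodic` is attained, then every step is tight. -/
theorem tight_of_periodic (hs : ∀ j, N + g (j + 1) ≤ D * x j + g j) {n : ℕ} (hn : 0 < n)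
    (hx : Function.Periodic x (n : ℤ)) (hg : Function.Periodic g (n : ℤ)) {a : ℤ}
    (heq : D * ∑ t ∈ Finset.range n, x (a + t) = N * n) (j : ℤ) :
    N + g (j + 1) = D * x j + g j := by
  -- Start the cycle at j: the other n - 1 steps obey the summed inequality, so any slack at j would
  -- contradict equality.
  rw [sum_range_add_eq_of_periodic hx a j] at heq
  obtain ⟨m, rfl⟩ := Nat.exists_eq_add_of_lt hn
  rw [zero_add] at heq hg
  have h1 := mul_add_potential_le hs (j + 1) m
  have h2 := hg j
  have h3 := hs j
  rw [Finset.sum_range_succ', mul_add] at heq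
  have e : ∀ t : ℕ, j + ((t + 1 : ℕ) : ℤ) = j + 1 + t := fun t => by push_cast; ring
  rw [e m] at h2
  simp only [e, Nat.cast_zero, add_zero, mul_add, mul_one] at heq
  omega

theorem sum_eq_of_tight (hs : ∀ j, N + g (j + 1) = D * x j + g j) (a : ℤ) (n : ℕ) :
    N * n + g (a + n) = D * ∑ t ∈ Finset.range n, x (a + t) + g a := by
  induction n with
  | zero => simp
  | succ n ih =>
    have := hs (a + n)
    rw [Finset.sum_range_succ, mul_add, mul_add]
    push_cast
    rw [← add_assoc]
    omega

/-- Along a closed walk, phases that advance by one at each step return after a multiple of their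
period. -/
theorem dvd_of_phase {phase : ℤ → ℕ × ℕ}
    (hstep : ∀ j, phase (j + 1) = ((phase j).1, ((phase j).2 + 1) % (phase j).1))
    {n : ℕ} (hn : phase n = phase 0) : (phase 0).1 ∣ n := by
  have key : ∀ m : ℕ, (phase m).1 = (phase 0).1 ∧
      (phase m).2 ≡ (phase 0).2 + m [MOD (phase 0).1] := by
    intro m
    induction m with
    | zero => exact ⟨rfl, rfl⟩
    | succ m ih =>
      push_cast
      rw [hstep, ih.1]
      exact ⟨rfl, (Nat.mod_modEq _ _).trans (by simpa [add_assoc] using ih.2.add_right 1)⟩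
  have h1 := (key n).2
  rw [hn] at h1
  have h2 : (phase 0).2 + 0 ≡ (phase 0).2 + n [MOD (phase 0).1] := h1
  exact (Nat.modEq_zero_iff_dvd.1 (Nat.ModEq.add_left_cancel' _ h2).symm)

end Potential

/-! ### Densities -/

theorem density_bitCode {h : ℕ} {f : ℤ → ℕ} (hf : ∀ j, f j < 2 ^ h) :
    density h (Subtype.val ⁻¹' bitCode f) = Filter.limsup (fun m : ℕ =>
      ((∑ t ∈ Finset.range (2 * m + 1), pop h (f (-m + t)) : ℕ) : ℝ) /
        ((h * (2 * m + 1) : ℕ) : ℝ)) Filter.atTop := by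
  simp only [density, ncard_window_bitCode hf, ncard_window]

theorem tendsto_sub_div_odd (c B : ℝ) :
    Filter.Tendsto (fun m : ℕ => c + B / (2 * m + 1 : ℝ)) Filter.atTop (nhds c) := by
  have h1 : Filter.Tendsto (fun m : ℕ => (2 * m + 1 : ℝ)) Filter.atTop Filter.atTop :=
    Filter.tendsto_atTop_add_const_right _ _
      (tendsto_natCast_atTop_atTop.const_mul_atTop (by norm_num))
  simpa using (h1.const_div_atTop B).const_add c

section Density

variable {h D N : ℕ} {f : ℤ → ℕ} {g : ℤ → ℕ} {B : ℕ}

/-- The end terms of the telescoped sum are at most B, which vanishes after division by 2m + 1. -/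
theorem le_density_bitCode (hh : 0 < h) (hD : 0 < D) (hf : ∀ j, f j < 2 ^ h)
    (hs : ∀ j, N + g (j + 1) ≤ D * pop h (f j) + g j) (hB : ∀ j, g j ≤ B) :
    (N : ℝ) / D / h ≤ density h (Subtype.val ⁻¹' bitCode f) := by
  rw [density_bitCode hf]
  have ht := tendsto_sub_div_odd ((N : ℝ) / D / h) (-(B / D / h))
  rw [← ht.limsup_eq]
  have hh' : (0 : ℝ) < h := by exact_mod_cast hh
  have hD' : (0 : ℝ) < D := by exact_mod_cast hD
  -- The real limsup is monotone only under boundedness; the ratios are at most 1.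
  refine Filter.limsup_le_limsup (Filter.Eventually.of_forall fun m => ?_)
    ht.isCoboundedUnder_le (Filter.isBoundedUnder_of ⟨1, fun m => ?_⟩)
  · have h1 := (mul_add_potential_le (x := fun j => pop h (f j)) hs (-m) (2 * m + 1)).trans
      (Nat.add_le_add_left (hB _) _)
    have h2 : (N * (2 * m + 1) : ℝ) ≤
        D * ((∑ t ∈ Finset.range (2 * m + 1), pop h (f (-m + t)) : ℕ) : ℝ) + B := by
      exact_mod_cast (Nat.le_add_right _ _).trans h1
    have hm : (0 : ℝ) < 2 * m + 1 := by positivity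
    have e : (N : ℝ) / D / h + -(B / D / h) / (2 * m + 1) =
        (N * (2 * m + 1) - B) / D / (h * (2 * m + 1)) := by
      field_simp
      ring
    dsimp only
    rw [e]
    push_cast at h2 ⊢
    refine div_le_div_of_nonneg_right ?_ (by positivity)
    rw [div_le_iff₀ hD']
    linarith
  · have h1 : ∑ t ∈ Finset.range (2 * m + 1), pop h (f (-m + t)) ≤ h * (2 * m + 1) := by
      refine (Finset.sum_le_card_nsmul _ _ h fun _ _ => pop_le _ _).trans_eq ?_
      simp [mul_comm]
    exact div_le_one_of_le₀ (by exact_mod_cast h1) (by positivity)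

/-- Tight steps pin the count within B on both sides, so the ratios converge. -/
theorem density_bitCode_eq (hh : 0 < h) (hD : 0 < D) (hf : ∀ j, f j < 2 ^ h)
    (hs : ∀ j, N + g (j + 1) = D * pop h (f j) + g j) (hB : ∀ j, g j ≤ B) :
    density h (Subtype.val ⁻¹' bitCode f) = (N : ℝ) / D / h := by
  rw [density_bitCode hf]
  have hh' : (0 : ℝ) < h := by exact_mod_cast hh
  have hD' : (0 : ℝ) < D := by exact_mod_cast hD
  refine Filter.Tendsto.limsup_eq (tendsto_of_tendsto_of_tendsto_of_le_of_le
    (tendsto_sub_div_odd ((N : ℝ) / D / h) (-(B / D / h)))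
    (tendsto_sub_div_odd ((N : ℝ) / D / h) (B / D / h)) (fun m => ?_) (fun m => ?_))
  all_goals
    have h1 := sum_eq_of_tight (x := fun j => pop h (f j)) hs (-m) (2 * m + 1)
    have h2 := hB (-m)
    have h3 := hB (-m + (2 * m + 1 : ℕ))
    have hm : (0 : ℝ) < 2 * m + 1 := by positivity
    dsimp only
  · have h4 : (N * (2 * m + 1) : ℝ) ≤
        D * ((∑ t ∈ Finset.range (2 * m + 1), pop h (f (-m + t)) : ℕ) : ℝ) + B := by
      have : N * (2 * m + 1) ≤
        D * (∑ t ∈ Finset.range (2 * m + 1), pop h (f (-m + t))) + B := by omega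
      exact_mod_cast this
    have e : (N : ℝ) / D / h + -(B / D / h) / (2 * m + 1) =
        (N * (2 * m + 1) - B) / D / (h * (2 * m + 1)) := by
      field_simp
      ring
    rw [e]
    push_cast at h4 ⊢
    refine div_le_div_of_nonneg_right ?_ (by positivity)
    rw [div_le_iff₀ hD']
    linarith
  · have h4 : D * ((∑ t ∈ Finset.range (2 * m + 1), pop h (f (-m + t)) : ℕ) : ℝ) ≤
        (N * (2 * m + 1) : ℝ) + B := by
      have : D * (∑ t ∈ Finset.range (2 * m + 1), pop h (f (-m + t))) ≤
        N * (2 * m + 1) + B := by omega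
      exact_mod_cast this
    have e : (N : ℝ) / D / h + (B / D / h) / (2 * m + 1) =
        (N * (2 * m + 1) + B) / D / (h * (2 * m + 1)) := by
      field_simp
    rw [e]
    push_cast at h4 ⊢
    refine div_le_div_of_nonneg_right ?_ (by positivity)
    rw [le_div_iff₀ hD']
    linarith

end Density

/-! ### Lower bounds from potentials -/

/-- `φ` is a function of four consecutive columns which shows that a code has at least `N / D`
vertices per column. -/
def IsPotential (h D N : ℕ) (φ : ℕ → ℕ → ℕ → ℕ → ℕ) : Prop :=
  ∀ a < 2 ^ h, ∀ b < 2 ^ h, ∀ c < 2 ^ h, ∀ d < 2 ^ h, ∀ e < 2 ^ h,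
    windowOK h a b c d e = true → N + φ b c d e ≤ D * pop h a + φ a b c d

/-- Along a tight step, the phase `(p, l)` of four consecutive columns becomes `(p, l + 1 mod p)`. -/
def IsPhase (h D N : ℕ) (φ : ℕ → ℕ → ℕ → ℕ → ℕ) (phase : ℕ → ℕ → ℕ → ℕ → ℕ × ℕ) : Prop :=
  ∀ a < 2 ^ h, ∀ b < 2 ^ h, ∀ c < 2 ^ h, ∀ d < 2 ^ h, ∀ e < 2 ^ h,
    windowOK h a b c d e = true → N + φ b c d e = D * pop h a + φ a b c d →
      phase b c d e = ((phase a b c d).1, ((phase a b c d).2 + 1) % (phase a b c d).1)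

section LowerBound

variable {h D N : ℕ} {φ : ℕ → ℕ → ℕ → ℕ → ℕ}

/-- The values of a function of four consecutive columns. -/
def slide {α : Type*} (φ : ℕ → ℕ → ℕ → ℕ → α) (f : ℤ → ℕ) (j : ℤ) : α :=
  φ (f j) (f (j + 1)) (f (j + 2)) (f (j + 3))

theorem slide_succ {α : Type*} (φ : ℕ → ℕ → ℕ → ℕ → α) (f : ℤ → ℕ) (j : ℤ) :
    slide φ f (j + 1) = φ (f (j + 1)) (f (j + 2)) (f (j + 3)) (f (j + 4)) := by
  simp only [slide, add_assoc]
  norm_num only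

theorem periodic_slide {α : Type*} (φ : ℕ → ℕ → ℕ → ℕ → α) {f : ℤ → ℕ} {c : ℤ}
    (hf : Function.Periodic f c) : Function.Periodic (slide φ f) c := by
  intro j
  simp only [slide, add_right_comm j c, hf _]

theorem IsPotential.step (hφ : IsPotential h D N φ) {f : ℤ → ℕ} (hf : ∀ j, f j < 2 ^ h)
    (hw : ∀ j, windowOK h (f j) (f (j + 1)) (f (j + 2)) (f (j + 3)) (f (j + 4)) = true) (j : ℤ) :
    N + slide φ f (j + 1) ≤ D * pop h (f j) + slide φ f j := by
  rw [slide_succ]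
  exact hφ _ (hf _) _ (hf _) _ (hf _) _ (hf _) _ (hf _) (hw j)

theorem exists_isLDCode_eq_LDS {n : ℕ} (hn : 5 ≤ n) : ∃ f : ℤ → ℕ, (∀ j, f j < 2 ^ h) ∧
    Function.Periodic f (n : ℤ) ∧
    (∀ j, windowOK h (f j) (f (j + 1)) (f (j + 2)) (f (j + 3)) (f (j + 4)) = true) ∧
    LDS n h = ∑ t ∈ Finset.range n, pop h (f (1 + t)) := by
  obtain ⟨C, -, hC, hcard⟩ := (isLeast_LDS n h).1
  obtain ⟨f, hf, hper, rfl⟩ := exists_bitCode hn C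
  exact ⟨f, hf, hper, (isLDCode_circularStrip_bitCode_iff hn hf hper).1 hC,
    by rw [← hcard, ncard_circularStrip_bitCode hf]⟩

theorem IsPotential.mul_le_LDS (hφ : IsPotential h D N φ) {n : ℕ} (hn : 5 ≤ n) :
    N * n ≤ D * LDS n h := by
  obtain ⟨f, hf, hper, hw, hcard⟩ := exists_isLDCode_eq_LDS (h := h) hn
  rw [hcard]
  exact mul_le_of_periodic (x := fun j => pop h (f j)) (hφ.step hf hw) (periodic_slide φ hper) 1

/-- A minimum code attaining the bound is a closed walk of n tight steps, along which the phase must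
return. -/
theorem IsPotential.exists_phase_dvd (hφ : IsPotential h D N φ)
    {phase : ℕ → ℕ → ℕ → ℕ → ℕ × ℕ} (hphase : IsPhase h D N φ phase) {n : ℕ} (hn : 5 ≤ n)
    (heq : D * LDS n h = N * n) : ∃ a b c d, (phase a b c d).1 ∣ n := by
  obtain ⟨f, hf, hper, hw, hcard⟩ := exists_isLDCode_eq_LDS (h := h) hn
  rw [hcard] at heq
  have ht := tight_of_periodic (x := fun j => pop h (f j)) (hφ.step hf hw) (by omega)
    (hper.comp (pop h)) (periodic_slide φ hper) heq
  refine ⟨_, _, _, _, dvd_of_phase (phase := slide phase f) (fun j => ?_) (n := n) ?_⟩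
  · have := ht j
    rw [slide_succ] at this ⊢
    exact hphase _ (hf _) _ (hf _) _ (hf _) _ (hf _) _ (hf _) (hw j) this
  · simpa using periodic_slide phase hper 0

theorem IsPotential.le_density (hφ : IsPotential h D N φ) (hh : 0 < h) (hD : 0 < D) {B : ℕ}
    (hB : ∀ a b c d, φ a b c d ≤ B) {C : Set (infiniteStripVertices h)}
    (hC : IsLDCode (infiniteStrip h) C) : (N : ℝ) / D / h ≤ density h C := by
  have e : Subtype.val ⁻¹' bitCode (columns h (Subtype.val '' C)) = C := by
    rw [preimage_bitCode_columns, Set.preimage_image_eq _ Subtype.val_injective]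
  rw [← e] at hC ⊢
  have hf := columns_lt h (Subtype.val '' C)
  exact le_density_bitCode hh hD hf (hφ.step hf ((isLDCode_bitCode_iff hf).1 hC))
    fun _ => hB _ _ _ _

/-- A periodic code that attains the bound of a potential is optimal. -/
theorem IsPotential.optimal_pattern (hφ : IsPotential h D N φ) (hh : 0 < h) (hD : 0 < D) {B : ℕ}
    (hB : ∀ a b c d, φ a b c d ≤ B) {f : ℤ → ℕ} (hf : ∀ j, f j < 2 ^ h)
    (hw : ∀ j, windowOK h (f j) (f (j + 1)) (f (j + 2)) (f (j + 3)) (f (j + 4)) = true)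
    {q : ℕ} (hq : 0 < q) (hper : Function.Periodic f (q : ℤ))
    (hcard : D * ∑ t ∈ Finset.range q, pop h (f (0 + t)) = N * q) :
    IsMinDensity h ((N : ℝ) / D / h) ∧ HasPeriodicPattern h q ((N : ℝ) / D / h) := by
  have ht := tight_of_periodic (x := fun j => pop h (f j)) (hφ.step hf hw) hq
    (hper.comp (pop h)) (periodic_slide φ hper) hcard
  have hd := density_bitCode_eq hh hD hf ht fun _ => hB _ _ _ _
  have hLD := (isLDCode_bitCode_iff hf).2 hw
  refine ⟨⟨⟨_, hLD, hd⟩, ?_⟩, bitCode f, ?_, hLD, hd, ?_⟩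
  · rintro _ ⟨C, hC, rfl⟩
    exact hφ.le_density hh hD hB hC
  · intro i j
    simp only [bitCode, Set.mem_ofPred_eq, hper j]
  · rintro n hn ⟨k, rfl⟩
    have hpern : Function.Periodic f ((q * k : ℕ) : ℤ) := by
      have := hper.nat_mul k
      push_cast at this ⊢
      rwa [mul_comm] at this
    refine ⟨(isLDCode_circularStrip_bitCode_iff hn hf hpern).2 hw, ?_⟩
    -- Tightness gives the exact count over any range; over whole periods the potential terms
    -- cancel.
    have h1 := sum_eq_of_tight (x := fun j => pop h (f j)) ht 1 (q * k)
    rw [periodic_slide φ hpern 1] at h1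
    rw [circularDensity, ncard_circularStrip_bitCode hf, card_stripVertices]
    have h2 : (N : ℝ) * (q * k : ℕ) =
        D * ((∑ t ∈ Finset.range (q * k), pop h (f (1 + t)) : ℕ) : ℝ) := by
      exact_mod_cast Nat.add_right_cancel h1
    have hh' : (0 : ℝ) < h := by exact_mod_cast hh
    have hD' : (0 : ℝ) < D := by exact_mod_cast hD
    have hn' : (0 : ℝ) < (q * k : ℕ) := by exact_mod_cast (by omega : 0 < q * k)
    rw [Nat.cast_mul h, div_div, div_eq_div_iff (by positivity) (by positivity)]
    linear_combination (-(h : ℝ)) * h2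

end LowerBound

/-! ### Upper bounds from words -/

section UpperBound

/-- All windows of five consecutive columns of the word satisfy `windowOK`. -/
def windowsOK (h : ℕ) : List ℕ → Bool
  | a :: b :: c :: d :: e :: l => windowOK h a b c d e && windowsOK h (b :: c :: d :: e :: l)
  | _ => true

/-- With an overlap of four columns, each window of five lies in one of the two words. -/
theorem windowsOK_append {h : ℕ} {s₁ s₂ s₃ s₄ : ℕ} {v : List ℕ}
    (hv : windowsOK h ([s₁, s₂, s₃, s₄] ++ v) = true) :
    ∀ u, windowsOK h (u ++ [s₁, s₂, s₃, s₄]) = true →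
      windowsOK h (u ++ ([s₁, s₂, s₃, s₄] ++ v)) = true
  | [], _ => hv
  | [a], hu => by
    have ih := windowsOK_append hv []
    simp_all [windowsOK]
  | [a, b], hu => by
    have ih := windowsOK_append hv [b]
    simp_all [windowsOK]
  | [a, b, c], hu => by
    have ih := windowsOK_append hv [b, c]
    simp_all [windowsOK]
  | [a, b, c, d], hu => by
    have ih := windowsOK_append hv [b, c, d]
    simp_all [windowsOK]
  | a :: b :: c :: d :: e :: u, hu => by
    have ih := windowsOK_append hv (b :: c :: d :: e :: u)
    simp_all [windowsOK]

theorem windowOK_getD_of_windowsOK {h : ℕ} : ∀ {l : List ℕ} (_ : windowsOK h l = true) (i : ℕ),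
    i + 4 < l.length → windowOK h (l.getD i 0) (l.getD (i + 1) 0) (l.getD (i + 2) 0)
      (l.getD (i + 3) 0) (l.getD (i + 4) 0) = true
  | a :: b :: c :: d :: e :: l, hl, 0, _ => by
    rw [windowsOK, Bool.and_eq_true] at hl
    exact hl.1
  | a :: b :: c :: d :: e :: l, hl, i + 1, hi => by
    rw [windowsOK, Bool.and_eq_true] at hl
    exact windowOK_getD_of_windowsOK hl.2 i (by simpa using hi)
  | [], _, i, hi => by simp at hi
  | [_], _, i, hi => by simp at hi
  | [_, _], _, i, hi => by simp at hi
  | [_, _, _], _, i, hi => by simp at hi; omega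
  | [_, _, _, _], _, i, hi => by simp at hi

/-- The periodic repetition of a word. -/
def repetition (w : List ℕ) (j : ℤ) : ℕ := w.getD (j % w.length).toNat 0

theorem periodic_repetition (w : List ℕ) : Function.Periodic (repetition w) (w.length : ℤ) := by
  intro j
  rw [repetition, Int.add_emod_right, repetition]

theorem repetition_lt {h : ℕ} {w : List ℕ} (hw : ∀ c ∈ w, c < 2 ^ h) (j : ℤ) :
    repetition w j < 2 ^ h := by
  rw [repetition]
  by_cases hj : (j % w.length).toNat < w.length
  · rw [List.getD_eq_getElem _ _ hj]
    exact hw _ (List.getElem_mem hj)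
  · rw [List.getD_eq_default _ _ (not_lt.1 hj)]
    positivity

theorem repetition_natCast {w : List ℕ} {i : ℕ} (hi : i < w.length) :
    repetition w i = w.getD i 0 := by
  rw [repetition, Int.emod_eq_of_lt (by omega) (by omega), Int.toNat_natCast]

/-- Appending the first four columns exposes the windows that cross the seam. -/
theorem windowOK_repetition {h : ℕ} {w : List ℕ} (hlen : 4 ≤ w.length)
    (hw : windowsOK h (w ++ w.take 4) = true) (j : ℤ) :
    windowOK h (repetition w j) (repetition w (j + 1)) (repetition w (j + 2))
      (repetition w (j + 3)) (repetition w (j + 4)) = true := by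
  obtain ⟨i, hi, hij⟩ : ∃ i : ℕ, i < w.length ∧ j = i + w.length * (j / w.length) := by
    refine ⟨(j % w.length).toNat, ?_, ?_⟩
    · have := Int.emod_lt_of_pos j (b := (w.length : ℤ)) (by omega)
      have := Int.emod_nonneg j (b := (w.length : ℤ)) (by omega)
      omega
    · have := Int.emod_nonneg j (b := (w.length : ℤ)) (by omega)
      rw [Int.toNat_of_nonneg this, Int.emod_add_mul_ediv]
  have key : ∀ t : ℕ, t ≤ 4 → repetition w (j + t) = (w ++ w.take 4).getD (i + t) 0 := by
    intro t ht
    have e : repetition w (j + t) = repetition w ((i + t : ℕ) : ℤ) := by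
      rw [repetition, repetition, hij, add_right_comm, Int.add_mul_emod_self_left]
      push_cast
      rfl
    rw [e]
    by_cases hit : i + t < w.length
    · rw [repetition_natCast hit, List.getD_append _ _ _ _ hit]
    · rw [List.getD_append_right _ _ _ _ (not_lt.1 hit)]
      have e2 := periodic_repetition w ((i + t - w.length : ℕ) : ℤ)
      rw [← Nat.cast_add, Nat.sub_add_cancel (not_lt.1 hit)] at e2
      rw [e2, repetition_natCast (by omega)]
      simp only [List.getD_eq_getElem?_getD, List.getElem?_take]
      rw [if_pos (by omega)]
  have := windowOK_getD_of_windowsOK hw i (by simp; omega)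
  have e0 := key 0 (by norm_num)
  have e1 := key 1 (by norm_num)
  have e2 := key 2 (by norm_num)
  have e3 := key 3 (by norm_num)
  have e4 := key 4 (by norm_num)
  norm_num at e0 e1 e2 e3 e4
  simp only [List.getD_eq_getElem?_getD] at this
  rwa [e0, e1, e2, e3, e4]

theorem sum_repetition (p : ℕ → ℕ) (w : List ℕ) :
    ∑ t ∈ Finset.range w.length, p (repetition w (0 + t)) = (w.map p).sum := by
  -- Induction on suffixes, with the prefix recording the position in the fixed word w.
  have : ∀ v u : List ℕ, u ++ v = w →
      ∑ t ∈ Finset.range v.length, p (repetition w ((u.length + t : ℕ) : ℤ)) = (v.map p).sum := by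
    intro v
    induction v with
    | nil => simp
    | cons c v ih =>
      intro u hu
      have h1 := ih (u ++ [c]) (by simpa using hu)
      rw [List.length_cons, Finset.sum_range_succ', List.map_cons, List.sum_cons, ← h1,
        add_comm, add_zero, repetition_natCast (by rw [← hu]; simp)]
      simp [← hu, add_assoc, add_comm 1]
  simpa using this w [] rfl

theorem LDS_le_of_windowsOK {h : ℕ} {w : List ℕ} (hlen : 5 ≤ w.length)
    (hlt : ∀ c ∈ w, c < 2 ^ h) (hw : windowsOK h (w ++ w.take 4) = true) :
    LDS w.length h ≤ (w.map (pop h)).sum := by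
  have hf := repetition_lt hlt
  have hper := periodic_repetition w
  refine Nat.sInf_le ⟨_, (isLDCode_circularStrip_bitCode_iff hlen hf hper).2
    (windowOK_repetition (by omega) hw), ?_⟩
  rw [ncard_circularStrip_bitCode hf, ← sum_repetition,
    sum_range_add_eq_of_periodic (x := fun j => pop h (repetition w j)) (hper.comp (pop h)) 1 0]

/-- Repetitions of the word `p` can be inserted in front of `w` if both start with the same four
columns. -/
theorem LDS_add_mul_le {h : ℕ} {s₁ s₂ s₃ s₄ : ℕ} {p w : List ℕ} (hlen : 5 ≤ w.length)
    (hp : p.take 4 = [s₁, s₂, s₃, s₄]) (hw : w.take 4 = [s₁, s₂, s₃, s₄])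
    (hlt : ∀ c ∈ p ++ w, c < 2 ^ h) (hpOK : windowsOK h (p ++ [s₁, s₂, s₃, s₄]) = true)
    (hwOK : windowsOK h (w ++ [s₁, s₂, s₃, s₄]) = true) (k : ℕ) :
    LDS (w.length + k * p.length) h ≤ (w.map (pop h)).sum + k * (p.map (pop h)).sum := by
  have key : ∃ v : List ℕ, v.length = w.length + k * p.length ∧ v.take 4 = [s₁, s₂, s₃, s₄] ∧
      (∀ c ∈ v, c < 2 ^ h) ∧ windowsOK h (v ++ [s₁, s₂, s₃, s₄]) = true ∧
      (v.map (pop h)).sum = (w.map (pop h)).sum + k * (p.map (pop h)).sum := by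
    induction k with
    | zero => exact ⟨w, by simp, hw, fun c hc => hlt c (by simp [hc]), hwOK, by simp⟩
    | succ k ih =>
      obtain ⟨v, h1, h2, h3, h4, h5⟩ := ih
      refine ⟨p ++ v, ?_, ?_, ?_, ?_, ?_⟩
      · rw [List.length_append, h1]
        ring
      · rw [List.take_append_of_le_length, hp]
        have := congrArg List.length hp
        rw [List.length_take] at this
        simp only [List.length_cons, List.length_nil] at this
        omega
      · intro c hc
        rcases List.mem_append.1 hc with hc | hc
        · exact hlt c (by simp [hc])
        · exact h3 c hc
      · rw [List.append_assoc, ← List.take_append_drop 4 v, h2, List.append_assoc]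
        rw [← List.take_append_drop 4 v, h2, List.append_assoc] at h4
        exact windowsOK_append h4 p hpOK
      · rw [List.map_append, List.sum_append, h5]
        ring
  obtain ⟨v, h1, h2, h3, h4, h5⟩ := key
  rw [← h1, ← h5]
  exact LDS_le_of_windowsOK (by omega) h3 (by rwa [h2])

end UpperBound

/-! ### The heights one, two and three -/

/-- Entry `s` of a table of bytes with `32` entries per row, the first entry of a row being the
least significant. -/
def lookup (T : List ℕ) (s : ℕ) : ℕ := (T.getD (s / 32) 0 >>> (8 * (s % 32))) % 256

theorem lookup_le (T : List ℕ) (s : ℕ) : lookup T s ≤ 255 :=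
  Nat.le_of_lt_succ (Nat.mod_lt _ (by norm_num))

/-- A potential for height one. -/
def potential₁ (a b c d : ℕ) : ℕ :=
  lookup [0x00000000000001000202020304040000] (8 * a + 4 * b + 2 * c + d)

set_option synthInstance.maxHeartbeats 400000 in
set_option synthInstance.maxSize 4000 in
-- A finite check over the 2^5 windows.
theorem isPotential₁ : IsPotential 1 5 2 potential₁ := by
  unfold IsPotential
  decide +kernel

/-- A potential for height two. -/
def potential₂ (a b c d : ℕ) : ℕ :=
  lookup [0x1b1b1b1b1c1c1d1c1e1e1e1e201f1f1f20202020202020202020202020202020,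
   0x101010101010101010101010101616181b1b1b1b1e1e1e1e1c1d1c1c201f1f1f,
   0x0e0e0e0e0e0e0e0e0e0e0e0e0e0e0e0e10101011171718170f0f0f0f16161616,
   0x0b0b0b0b0b0b0b0b0b0b0b0b0b0b0b0b0c0c0c0c111111110d0d0d0e12121312,
   0x0c0c0c0c0d0d0d0e1111111112131212101010110f0f0f0f1718171716161616,
   0x0b0b0b0b0b0b0b0b0b0b0b0b0b0b0b0b0e0e0e0e0e0e0e0e0e0e0e0e0e0e0e0e,
   0x0000000000000000000000000000000000000000060606070606060708080808] (64 * a + 16 * b + 4 * c + d)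

/-- The position in one of the two cycles of tight steps. -/
def phase₂ (a b c d : ℕ) : ℕ × ℕ :=
  -- The entries encode the cyclic factors of 01030203 and 01210212 in base 4. `idxOf` of a missing
  -- entry is 8, hence 0 modulo 8, so `max` picks the index from the list containing the state.
  (8, max ([19, 76, 50, 200, 35, 140, 49, 196].idxOf (64 * a + 16 * b + 4 * c + d) % 8)
    ([25, 100, 146, 73, 38, 152, 97, 134].idxOf (64 * a + 16 * b + 4 * c + d) % 8))

set_option synthInstance.maxHeartbeats 400000 in
set_option synthInstance.maxSize 4000 in
-- The ratio 3/4 is scaled to 15/20, leaving room for an integral potential whose tight steps all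
-- respect the phase.
theorem potential₂_step : ∀ a < 4, ∀ b < 4, ∀ c < 4, ∀ d < 4, ∀ e < 4,
    windowOK 2 a b c d e = true →
      15 + potential₂ b c d e ≤ 20 * pop 2 a + potential₂ a b c d ∧
      (15 + potential₂ b c d e = 20 * pop 2 a + potential₂ a b c d →
        phase₂ b c d e = ((phase₂ a b c d).1, ((phase₂ a b c d).2 + 1) % (phase₂ a b c d).1)) := by
  decide +kernel

theorem isPotential₂ : IsPotential 2 20 15 potential₂ :=
  fun a ha b hb c hc d hd e he hw => (potential₂_step a ha b hb c hc d hd e he hw).1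

theorem isPhase₂ : IsPhase 2 20 15 potential₂ phase₂ :=
  fun a ha b hb c hc d hd e he hw => (potential₂_step a ha b hb c hc d hd e he hw).2

/-- A potential for height three. It depends on three columns only. -/
def potential₃ (a b c _ : ℕ) : ℕ :=
  lookup [0x1414141418181819171c181c1c001c0018181c1c000000001e00000000000000,
   0x0f0f0f0f0f0f0f101418141814181419171717171718171818001c0018001c00,
   0x1010101010101010111211121112121214141414000000001415000000000000,
   0x0909090909090909090c090c090c090c0d0d0d0d0d0d0d0d0d1114150d121515,
   0x0d0d0d0d0d0d0d0d11111111110011000d0d1112000000001100180000000000,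
   0x08080808080808080d0d0d0d0d0d0d0d09090909090a090a0d0011000d001200,
   0x0909090909090909090909090909090909090909000000000a0b0b0b00000000,
   0x0505050505050505050505050505050505050505050505050505080805050808,
   0x090909090c0c0c0c11111112121212120d0d1415111215151400000015000000,
   0x090909090909090910101010101010100d0d0d0d0d0d0d0d1400140014001400,
   0x0808080808080808090909090909090a080808080808080809090000090a0000,
   0x0808080808080808080808080808080808080808080808080808080808080808,
   0x0505050505050505090909090909090905050808050508080a000b000b000b00,
   0x0505050505050505090909090909090905050505050505050900090009000900,
   0x0000000000000000000000000000000000000000000000000101010101010102,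
   0] (64 * a + 8 * b + c)

/-- The phases of the states on cycles of tight steps: modulo two or modulo three. -/
def phase₃ (a b c _ : ℕ) : ℕ × ℕ :=
  if 64 * a + 8 * b + c ∈ [0o030, 0o060, 0o121, 0o142, 0o241, 0o141] then (2, 0)
  else if 64 * a + 8 * b + c ∈ [0o306, 0o603, 0o214, 0o424, 0o412, 0o414] then (2, 1)
  else if 64 * a + 8 * b + c ∈ [0o007, 0o025, 0o205] then (3, 0)
  else if 64 * a + 8 * b + c ∈ [0o070, 0o250, 0o252, 0o050, 0o052] then (3, 1)
  else (3, 2)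

set_option synthInstance.maxHeartbeats 400000 in
set_option synthInstance.maxSize 4000 in
-- Four columns suffice: `rowOK` is not needed for this bound. The ignored last argument is set to
-- 0, and testing `columnOK` before quantifying over d prunes the search.
theorem potential₃_step : ∀ a < 8, ∀ b < 8, ∀ c < 8, columnOK 3 a b c = true →
    ∀ d < 8, diagonalOK 3 a b c d = true →
      14 + potential₃ b c d 0 ≤ 14 * pop 3 a + potential₃ a b c 0 ∧
      (14 + potential₃ b c d 0 = 14 * pop 3 a + potential₃ a b c 0 →
        phase₃ b c d 0 = ((phase₃ a b c 0).1, ((phase₃ a b c 0).2 + 1) % (phase₃ a b c 0).1)) := by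
  decide +kernel

theorem potential₃_step' {a b c d e : ℕ} (ha : a < 2 ^ 3) (hb : b < 2 ^ 3) (hc : c < 2 ^ 3)
    (hd : d < 2 ^ 3) (hw : windowOK 3 a b c d e = true) :
    14 + potential₃ b c d e ≤ 14 * pop 3 a + potential₃ a b c d ∧
      (14 + potential₃ b c d e = 14 * pop 3 a + potential₃ a b c d →
        phase₃ b c d e = ((phase₃ a b c d).1, ((phase₃ a b c d).2 + 1) % (phase₃ a b c d).1)) := by
  rw [windowOK, Bool.and_eq_true, Bool.and_eq_true] at hw
  exact potential₃_step a ha b hb c hc hw.1.1 d hd hw.1.2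

theorem isPotential₃ : IsPotential 3 14 14 potential₃ :=
  fun _ ha _ hb _ hc _ hd _ _ hw => (potential₃_step' ha hb hc hd hw).1

theorem isPhase₃ : IsPhase 3 14 14 potential₃ phase₃ :=
  fun _ ha _ hb _ hc _ hd _ _ hw => (potential₃_step' ha hb hc hd hw).2

/-- A decidable form of `LDS_add_mul_le`. -/
def wordsOK (h : ℕ) (p w : List ℕ) : Bool :=
  4 ≤ p.length && p.take 4 == w.take 4 && (p ++ w).all (· < 2 ^ h) &&
    windowsOK h (p ++ p.take 4) && windowsOK h (w ++ w.take 4)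

theorem LDS_add_mul_le_of_wordsOK {h : ℕ} (p w : List ℕ) (hlen : 5 ≤ w.length)
    (hOK : wordsOK h p w = true) (k : ℕ) :
    LDS (w.length + k * p.length) h ≤ (w.map (pop h)).sum + k * (p.map (pop h)).sum := by
  simp only [wordsOK, Bool.and_eq_true, decide_eq_true_eq, beq_iff_eq, List.all_eq_true] at hOK
  obtain ⟨⟨⟨⟨h1, h2⟩, h3⟩, h4⟩, h5⟩ := hOK
  obtain ⟨s₁, s₂, s₃, s₄, hs⟩ : ∃ s₁ s₂ s₃ s₄, p.take 4 = [s₁, s₂, s₃, s₄] := by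
    obtain _ | ⟨s₁, _ | ⟨s₂, _ | ⟨s₃, _ | ⟨s₄, p⟩⟩⟩⟩ := p
    on_goal 5 => exact ⟨s₁, s₂, s₃, s₄, rfl⟩
    all_goals simp at h1
  rw [hs] at h2 h4
  rw [← h2] at h5
  exact LDS_add_mul_le hlen hs h2.symm h3 h4 h5 k

/-! ### Exact values for the heights one, two and three -/

theorem LDS_one {n : ℕ} (hn : 5 ≤ n) : LDS n 1 = (2 * n + 4) / 5 := by
  obtain ⟨r, k, h1, h2, rfl⟩ : ∃ r k, 5 ≤ r ∧ r < 10 ∧ n = r + k * 5 :=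
    ⟨n % 5 + 5, n / 5 - 1, by omega, by omega, by omega⟩
  have lower := isPotential₁.mul_le_LDS hn
  have upper : LDS (r + k * 5) 1 ≤ (2 * r + 4) / 5 + k * 2 := by
    interval_cases r
    · exact LDS_add_mul_le_of_wordsOK [0, 1, 0, 1, 0] [0, 1, 0, 1, 0] (by decide) (by decide) k
    · exact LDS_add_mul_le_of_wordsOK [0, 1, 0, 1, 0] [0, 1, 0, 1, 0, 1] (by decide) (by decide) k
    · exact LDS_add_mul_le_of_wordsOK [0, 1, 0, 1, 0] [0, 1, 0, 1, 0, 1, 0] (by decide)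
        (by decide) k
    · exact LDS_add_mul_le_of_wordsOK [0, 1, 0, 1, 0] [0, 1, 0, 1, 0, 1, 0, 1] (by decide)
        (by decide) k
    · exact LDS_add_mul_le_of_wordsOK [0, 1, 0, 1, 0] [0, 1, 0, 1, 0, 1, 0, 1, 0] (by decide)
        (by decide) k
  omega

theorem LDS_two {n : ℕ} (hn : 5 ≤ n) :
    LDS n 2 = (3 * n + 3) / 4 + if n % 8 = 4 then 1 else 0 := by
  have lower := isPotential₂.mul_le_LDS hn
  have strict : n % 8 = 4 → 20 * LDS n 2 ≠ 15 * n := by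
    intro h8 heq
    obtain ⟨a, b, c, d, hdvd⟩ := isPotential₂.exists_phase_dvd isPhase₂ hn heq
    have : 8 ∣ n := hdvd
    omega
  obtain ⟨r, k, h1, h2, rfl⟩ : ∃ r k, 5 ≤ r ∧ r < 13 ∧ n = r + k * 8 :=
    ⟨(n + 3) % 8 + 5, (n + 3) / 8 - 1, by omega, by omega, by omega⟩
  have upper : LDS (r + k * 8) 2 ≤ ((3 * r + 3) / 4 + if r % 8 = 4 then 1 else 0) + k * 6 := by
    interval_cases r
    -- Residue 5 uses the other cycle of tight steps, since the inserted pattern must share its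
    -- first four columns with the word.
    · exact LDS_add_mul_le_of_wordsOK [0, 1, 2, 1, 0, 2, 1, 2]
        [0, 1, 2, 1, 2] (by decide) (by decide) k
    · exact LDS_add_mul_le_of_wordsOK [0, 1, 0, 3, 0, 2, 0, 3]
        [0, 1, 0, 3, 0, 3] (by decide) (by decide) k
    · exact LDS_add_mul_le_of_wordsOK [0, 1, 0, 3, 0, 2, 0, 3]
        [0, 1, 0, 3, 0, 2, 3] (by decide) (by decide) k
    · exact LDS_add_mul_le_of_wordsOK [0, 1, 0, 3, 0, 2, 0, 3]
        [0, 1, 0, 3, 0, 2, 0, 3] (by decide) (by decide) k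
    · exact LDS_add_mul_le_of_wordsOK [0, 1, 0, 3, 0, 2, 0, 3]
        [0, 1, 0, 3, 0, 2, 2, 0, 3] (by decide) (by decide) k
    · exact LDS_add_mul_le_of_wordsOK [0, 1, 0, 3, 0, 2, 0, 3]
        [0, 1, 0, 3, 0, 2, 0, 3, 0, 3] (by decide) (by decide) k
    · exact LDS_add_mul_le_of_wordsOK [0, 1, 0, 3, 0, 2, 0, 3]
        [0, 1, 0, 3, 0, 2, 0, 3, 0, 1, 3] (by decide) (by decide) k
    · exact LDS_add_mul_le_of_wordsOK [0, 1, 0, 3, 0, 2, 0, 3]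
        [0, 1, 0, 3, 0, 2, 0, 3, 0, 1, 1, 3] (by decide) (by decide) k
  split_ifs at * <;> omega

theorem LDS_three {n : ℕ} (hn : 5 ≤ n) :
    LDS n 3 = n + if n % 6 = 1 ∨ n % 6 = 5 then 1 else 0 := by
  have lower := isPotential₃.mul_le_LDS hn
  have strict : n % 6 = 1 ∨ n % 6 = 5 → 14 * LDS n 3 ≠ 14 * n := by
    intro h6 heq
    obtain ⟨a, b, c, d, hdvd⟩ := isPotential₃.exists_phase_dvd isPhase₃ hn heq
    -- Tight closed walks have length divisible by 2 or by 3.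
    have : 2 ∣ n ∨ 3 ∣ n := by
      unfold phase₃ at hdvd
      split_ifs at hdvd
      exacts [Or.inl hdvd, Or.inl hdvd, Or.inr hdvd, Or.inr hdvd, Or.inr hdvd]
    omega
  obtain ⟨r, k, h1, h2, rfl⟩ : ∃ r k, 5 ≤ r ∧ r < 11 ∧ n = r + k * 6 :=
    ⟨(n + 1) % 6 + 5, (n + 1) / 6 - 1, by omega, by omega, by omega⟩
  have upper : LDS (r + k * 6) 3 ≤ (r + if r % 6 = 1 ∨ r % 6 = 5 then 1 else 0) + k * 6 := by
    interval_cases r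
    · exact LDS_add_mul_le_of_wordsOK [1, 4, 1, 4, 1, 4]
        [1, 4, 1, 4, 5] (by decide) (by decide) k
    · exact LDS_add_mul_le_of_wordsOK [1, 4, 1, 4, 1, 4]
        [1, 4, 1, 4, 1, 4] (by decide) (by decide) k
    · exact LDS_add_mul_le_of_wordsOK [1, 4, 1, 4, 1, 4]
        [1, 4, 1, 4, 1, 4, 5] (by decide) (by decide) k
    · exact LDS_add_mul_le_of_wordsOK [1, 4, 1, 4, 1, 4]
        [1, 4, 1, 4, 1, 4, 1, 4] (by decide) (by decide) k
    -- An odd multiple of 3 needs the pattern of period 3; the one of period 2 does not close up.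
    · exact LDS_add_mul_le_of_wordsOK [0, 2, 5, 0, 2, 5]
        [0, 2, 5, 0, 2, 5, 0, 2, 5] (by decide) (by decide) k
    · exact LDS_add_mul_le_of_wordsOK [1, 4, 1, 4, 1, 4]
        [1, 4, 1, 4, 1, 4, 1, 4, 1, 4] (by decide) (by decide) k
  split_ifs at * <;> omega

/-! ### Periods -/

theorem hasPeriod_one : HasPeriodAndTransferFactor (fun n => LDS n 1) 5 2 := by
  refine ⟨fun n hn => ?_, ⟨by norm_num, 2, 5, fun n hn => ?_⟩, ?_⟩
  · dsimp only
    rw [LDS_one hn, LDS_one (by omega)]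
    omega
  · dsimp only
    rw [LDS_one hn, LDS_one (by omega)]
    omega
  · rintro q ⟨hq, d, u, hu⟩
    have key : ∀ n, u + 5 ≤ n → (2 * (n + q) + 4) / 5 = (2 * n + 4) / 5 + d := fun n hn => by
      rw [← LDS_one (by omega), ← LDS_one (by omega)]
      exact hu n (by omega)
    -- A multiple of 5 past the threshold, so that i is the residue; a few residues refute each
    -- smaller q.
    have h (i : ℕ) := key (5 * u + 5 + i) (by omega)
    have h0 := h 0
    have h1 := h 1
    have h2 := h 2
    have h3 := h 3
    by_contra! hq5
    change q < 5 at hq5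
    clear h key hu
    interval_cases q <;> omega

theorem hasPeriod_two : HasPeriodAndTransferFactor (fun n => LDS n 2) 8 6 := by
  have hp : PseudoPeriodic (fun n => LDS n 2) 6 8 5 := fun n hn => by
    dsimp only
    rw [LDS_two hn, LDS_two (by omega), show (n + 8) % 8 = n % 8 by omega]
    omega
  refine ⟨hp, ⟨by norm_num, 6, 5, hp⟩, ?_⟩
  rintro q ⟨hq, d, u, hu⟩
  have key : ∀ n, u + 5 ≤ n → ((3 * (n + q) + 3) / 4 + if (n + q) % 8 = 4 then 1 else 0) =
      ((3 * n + 3) / 4 + if n % 8 = 4 then 1 else 0) + d := fun n hn => by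
    rw [← LDS_two (by omega), ← LDS_two (by omega)]
    exact hu n (by omega)
  by_contra! hq8
  have h (i : ℕ) := key (8 * u + 8 + i) (by omega)
  have h0 := h 0
  have h2 := h 2
  have h3 := h 3
  have h4 := h 4
  clear h key hu hp
  change q < 8 at hq8
  interval_cases q <;> simp [Nat.add_mod] at h0 h2 h3 h4 <;> omega

theorem hasPeriod_three : HasPeriodAndTransferFactor (fun n => LDS n 3) 6 6 := by
  have hp : PseudoPeriodic (fun n => LDS n 3) 6 6 5 := fun n hn => by
    dsimp only
    rw [LDS_three hn, LDS_three (by omega), show (n + 6) % 6 = n % 6 by omega]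
    omega
  refine ⟨hp, ⟨by norm_num, 6, 5, hp⟩, ?_⟩
  rintro q ⟨hq, d, u, hu⟩
  have key : ∀ n, u + 5 ≤ n → (n + q + if (n + q) % 6 = 1 ∨ (n + q) % 6 = 5 then 1 else 0) =
      (n + if n % 6 = 1 ∨ n % 6 = 5 then 1 else 0) + d := fun n hn => by
    rw [← LDS_three (by omega), ← LDS_three (by omega)]
    exact hu n (by omega)
  by_contra! hq6
  have h (i : ℕ) := key (6 * u + 6 + i) (by omega)
  have h0 := h 0
  have h1 := h 1
  have h5 := h 5
  clear h key hu hp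
  change q < 6 at hq6
  interval_cases q <;> simp [Nat.add_mod] at h0 h1 h5 <;> omega

/-! ### Optimal patterns -/

theorem optimal_repetition {h D N : ℕ} {φ : ℕ → ℕ → ℕ → ℕ → ℕ} (hφ : IsPotential h D N φ)
    (hh : 0 < h) (hD : 0 < D) {B : ℕ} (hB : ∀ a b c d, φ a b c d ≤ B) (w : List ℕ)
    (hlen : 4 ≤ w.length) (hlt : ∀ c ∈ w, c < 2 ^ h) (hw : windowsOK h (w ++ w.take 4) = true)
    (hcard : D * (w.map (pop h)).sum = N * w.length) :
    IsMinDensity h ((N : ℝ) / D / h) ∧ HasPeriodicPattern h w.length ((N : ℝ) / D / h) := by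
  refine hφ.optimal_pattern hh hD hB (repetition_lt hlt) (windowOK_repetition hlen hw) (by omega)
    (periodic_repetition w) ?_
  rw [sum_repetition, hcard]

theorem pattern_one : IsMinDensity 1 (2 / 5) ∧ HasPeriodicPattern 1 5 (2 / 5) := by
  have := optimal_repetition isPotential₁ one_pos (by norm_num)
    (fun _ _ _ _ => lookup_le _ _) [0, 1, 0, 1, 0] (by decide) (by decide) (by decide) (by decide)
  norm_num at this
  exact this

theorem pattern_two : IsMinDensity 2 (3 / 8) ∧ HasPeriodicPattern 2 8 (3 / 8) := by
  have := optimal_repetition isPotential₂ two_pos (by norm_num)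
    (fun _ _ _ _ => lookup_le _ _) [0, 1, 0, 3, 0, 2, 0, 3] (by decide) (by decide) (by decide)
    (by decide)
  norm_num at this
  exact this

theorem pattern_three : IsMinDensity 3 (1 / 3) ∧ HasPeriodicPattern 3 2 (1 / 3) := by
  -- The window check needs a word of at least four columns, so the pattern 1, 4 is written three
  -- times and its period 2 is verified separately.
  have hper : Function.Periodic (repetition [1, 4, 1, 4, 1, 4]) ((2 : ℕ) : ℤ) := by
    intro j
    simp only [repetition, List.length_cons, List.length_nil]
    have h0 := Int.emod_nonneg j (b := 6) (by norm_num)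
    have h6 := Int.emod_lt_of_pos j (b := 6) (by norm_num)
    norm_num
    rw [Int.add_emod]
    generalize j % 6 = i at *
    interval_cases i <;> rfl
  have := isPotential₃.optimal_pattern (by norm_num) (by norm_num) (fun _ _ _ _ => lookup_le _ _)
    (repetition_lt (by decide)) (windowOK_repetition (by decide) (by decide)) two_pos hper
    (by decide)
  norm_num at this
  exact this

theorem ceil_natCast_div (a b : ℕ) (hb : 0 < b) : ⌈(a : ℝ) / b⌉₊ = (a + b - 1) / b := by
  have hb' : (0 : ℝ) < b := by exact_mod_cast hb
  apply eq_of_forall_ge_iff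
  intro c
  rw [Nat.ceil_le, div_le_iff₀ hb', ← Nat.lt_succ_iff, Nat.div_lt_iff_lt_mul hb]
  norm_cast
  rw [Nat.succ_mul]
  omega

end GridCodes

theorem mainTheorem6 :
    -- height 1
    ((∀ n : ℕ, 5 ≤ n → GridCodes.LDS n 1 = ⌈(2 * n : ℝ) / 5⌉₊) ∧
      GridCodes.HasPeriodAndTransferFactor (fun n => GridCodes.LDS n 1) 5 2 ∧
      GridCodes.IsMinDensity 1 (2 / 5) ∧
      GridCodes.HasPeriodicPattern 1 5 (2 / 5)) ∧
    -- height 2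
    ((∀ n : ℕ, 5 ≤ n →
        (n % 8 ≠ 4 → GridCodes.LDS n 2 = ⌈(3 * n : ℝ) / 4⌉₊) ∧
        (n % 8 = 4 → (GridCodes.LDS n 2 : ℝ) = (3 * n : ℝ) / 4 + 1)) ∧
      GridCodes.HasPeriodAndTransferFactor (fun n => GridCodes.LDS n 2) 8 6 ∧
      GridCodes.IsMinDensity 2 (3 / 8) ∧
      GridCodes.HasPeriodicPattern 2 8 (3 / 8)) ∧
    -- height 3
    ((∀ n : ℕ, 5 ≤ n →
        (n % 6 = 0 ∨ n % 6 = 2 ∨ n % 6 = 3 ∨ n % 6 = 4 → GridCodes.LDS n 3 = n) ∧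
        (n % 6 = 1 ∨ n % 6 = 5 → GridCodes.LDS n 3 = n + 1)) ∧
      GridCodes.HasPeriodAndTransferFactor (fun n => GridCodes.LDS n 3) 6 6 ∧
      GridCodes.IsMinDensity 3 (1 / 3) ∧
      GridCodes.HasPeriodicPattern 3 2 (1 / 3)) := by
  refine ⟨⟨fun n hn => ?_, GridCodes.hasPeriod_one, GridCodes.pattern_one⟩,
    ⟨fun n hn => ⟨fun h8 => ?_, fun h8 => ?_⟩, GridCodes.hasPeriod_two, GridCodes.pattern_two⟩,
    ⟨fun n hn => ⟨fun h6 => ?_, fun h6 => ?_⟩, GridCodes.hasPeriod_three,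
      GridCodes.pattern_three⟩⟩
  · have := GridCodes.ceil_natCast_div (2 * n) 5 (by norm_num)
    push_cast at this
    rw [this, GridCodes.LDS_one hn]
  · have := GridCodes.ceil_natCast_div (3 * n) 4 (by norm_num)
    push_cast at this
    rw [this, GridCodes.LDS_two hn, if_neg h8]
    omega
  -- Now 3n/4 = 6k + 3 is an integer.
  · obtain ⟨k, rfl⟩ : ∃ k, n = 8 * k + 4 := ⟨n / 8, by omega⟩
    have : GridCodes.LDS (8 * k + 4) 2 = 6 * k + 4 := by
      rw [GridCodes.LDS_two hn, if_pos h8]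
      omega
    rw [this]
    push_cast
    ring
  · rw [GridCodes.LDS_three hn, if_neg (by omega), add_zero]
  · rw [GridCodes.LDS_three hn, if_pos h6]
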